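/- Let $I,J$ be finite index sets, let $\mathcal E_{1,i}$ ($i\in I$) and $\mathcal E_{2,j}$ ($j\in J$) be finite-dimensional Euclidean spaces, and let $\mathcal E_1=\bigoplus_{i\in I}\mathcal E_{1,i}$ and $\mathcal E_2=\bigoplus_{j\in J}\mathcal E_{2,j}$ carry the inner products $\langle x,z\rangle=\sum_i\langle x_i,z_i\rangle$. Let $f_i:\mathcal E_{1,i}\to(-\infty,+\infty]$ and $g_j:\mathcal E_{2,j}\to(-\infty,+\infty]$ be proper lower semicontinuous convex functions, let $\mathcal A_{ji}:\mathcal E_{1,i}\to\mathcal E_{2,j}$ be linear, and put $$f(x)=\sum_{i\in I}f_i(x_i),\quad g(y)=\sum_{j\in J}g_j(y_j),\quad \mathcal A_jx=\sum_{i\in I}\mathcal A_{ji}x_i,\quad \mathcal Ax=(\mathcal A_jx)_{j\in J}.$$ Consider the primal problem $\min_{x\in\mathcal E_1} f(x)+g(\mathcal Ax)$ and the dual problem $\min_{y\in\mathcal E_2}D(y)$, where $$D(y)=\sum_{i\in I}f_i^*\Big(-\sum_{j\in J}\mathcal A_{ji}^*y_j\Big)+\sum_{j\in J}g_j^*(y_j)$$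 and $\phi^*(y)=\sup_x\{\langle x,y\rangle-\phi(x)\}$ is the Fenchel conjugate. Write $D^*=\inf D$, $\mathcal Y=\{y: D(y)\le D(z)\ \forall z\in\mathcal E_2\}$, $d(y,\mathcal Y)$ for the distance from $y$ to $\mathcal Y$, and $\mathbb B_r$ for the closed ball of radius $r$ about $0$. Assume that the primal problem has an optimal solution $\bar x$ and that one of the following holds: $0\in\mathrm{ri}(\mathrm{dom}\,g-\mathcal A\,\mathrm{dom}\,f)$; or $g$ is polyhedral (its epigraph is a polyhedral convex set) and $\mathrm{dom}\,g\cap\mathcal A\,\mathrm{ri}\,\mathrm{dom}\,f\neq\emptyset$; or $f$ and $g$ are both polyhedral and $\mathrm{dom}\,g\cap\mathcal A\,\mathrm{dom}\,f\neq\emptyset$. Assume further that $f$ is essentially strictly convex, i.e. strictly convex on every convex subset of $\{x:\partial f(x)\ne\emptyset\}$. Then $D^*$ is finite, $\mathcal Y\neq\emptyset$, and the bounded quadratic growth condition holds: for every $r>0$ there is $\sigma>0$ such that $$D(y)\ \ge\ D^*+\frac{\sigma}{2}\,d^2(y,\mathcal Y)\qquad\forall y\in\mathbb B_r,$$ provided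 that one of the following two conditions is satisfied: (i) $\partial f_i$ is upper Lipschitz continuous at $\bar x_i$ for every $i\in I$, $\partial g_j$ is upper Lipschitz continuous at $\mathcal A_j\bar x$ for every $j\in J$, and $0\in\mathrm{ri}\big(\partial f(\bar x)+\mathcal A^*\partial g(\mathcal A\bar x)\big)$. Here a multifunction $\Psi$ is upper Lipschitz continuous at $\bar u$ if there are $\delta,\kappa>0$ such that $\Psi(u)\subseteq\Psi(\bar u)+\kappa\|u-\bar u\|\,\mathbb B_1$ for all $u$ with $\|u-\bar u\|\le\delta$. (ii) All $\partial f_i$ ($i\in I$) and all $\partial g_j$ ($j\in J$) are polyhedral multifunctions, i.e. the graph of each is a union of finitely many polyhedral convex sets. -/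

import Mathlib

open scoped Pointwise InnerProductSpace

noncomputable section

namespace CompositeDual

section General

variable {E F : Type*} [NormedAddCommGroup E] [InnerProductSpace ℝ E]
  [NormedAddCommGroup F] [InnerProductSpace ℝ F]

/-- The epigraph of an extended-real-valued function. -/
def epigraph (φ : E → EReal) : Set (E × ℝ) := {p | φ p.1 ≤ (p.2 : EReal)}

/-- The effective domain of `φ`. -/
def effDom (φ : E → EReal) : Set E := {x | φ x < ⊤}

/-- The class `Γ₀(E)` of proper, lower semicontinuous, convex functions `E → (-∞, +∞]`. -/
structure IsGammaZero (φ : E → EReal) : Prop where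
  ne_bot : ∀ x, φ x ≠ ⊥
  nonempty_effDom : (effDom φ).Nonempty
  convex_epigraph : Convex ℝ (epigraph φ)
  lsc : LowerSemicontinuous φ

/-- The Fenchel conjugate `φ*(y) = sup_x (⟨x, y⟩ - φ(x))`. -/
def conjugate (φ : E → EReal) (y : E) : EReal := ⨆ x : E, ((⟪x, y⟫_ℝ : ℝ) : EReal) - φ x

/-- The subdifferential `∂φ(x)`. -/
def subdiff (φ : E → EReal) (x : E) : Set E :=
  {y | ∀ u : E, φ x + ((⟪y, u - x⟫_ℝ : ℝ) : EReal) ≤ φ u}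

/-- `φ` is strictly convex on every convex subset of `{x | ∂φ(x) ≠ ∅}`.
A proper `φ` is finite at every point where it is subdifferentiable, so `toReal` only
reinterprets the finite values of `φ` as reals there. -/
def EssentiallyStrictlyConvex (φ : E → EReal) : Prop :=
  ∀ S : Set E, S ⊆ {x | (subdiff φ x).Nonempty} → Convex ℝ S →
    StrictConvexOn ℝ S (fun x => (φ x).toReal)

/-- Upper Lipschitz continuity of the multifunction `Ψ` at `a`: for some `δ, κ > 0`,
`Ψ(x) ⊆ Ψ(a) + κ ‖x - a‖ 𝔹` for all `x` in the closed ball `𝔹(a, δ)`. -/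
def UpperLipschitzAt (Ψ : E → Set F) (a : E) : Prop :=
  ∃ δ > (0 : ℝ), ∃ κ > (0 : ℝ), ∀ x ∈ Metric.closedBall a δ,
    Ψ x ⊆ Ψ a + (κ * ‖x - a‖) • Metric.closedBall (0 : F) 1

/-- The set of minimizers of `φ`. -/
def minimizers (φ : E → EReal) : Set E := {y | ∀ z, φ y ≤ φ z}

/-- Bounded quadratic growth: for every `r > 0` there is `σ > 0` such that
`φ(y) ≥ inf φ + (σ / 2) d(y, argmin φ)²` on the closed ball of radius `r` about `0`. -/
def BoundedQuadraticGrowth (φ : E → EReal) : Prop :=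
  ∀ r > (0 : ℝ), ∃ σ > (0 : ℝ), ∀ y ∈ Metric.closedBall (0 : E) r,
    (⨅ z, φ z) + ((σ / 2 * Metric.infDist y (minimizers φ) ^ 2 : ℝ) : EReal) ≤ φ y

end General

/-- A polyhedral convex set: the solution set of finitely many linear inequalities. -/
def IsPolyhedralSet {V : Type*} [AddCommGroup V] [Module ℝ V] (S : Set V) : Prop :=
  ∃ (n : ℕ) (a : Fin n → Module.Dual ℝ V) (b : Fin n → ℝ), S = {x | ∀ k, a k x ≤ b k}

section Polyhedral

variable {E F : Type*} [NormedAddCommGroup E] [InnerProductSpace ℝ E]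
  [NormedAddCommGroup F] [InnerProductSpace ℝ F]

/-- A polyhedral function: its epigraph is a polyhedral convex set. -/
def IsPolyhedralFun (φ : E → EReal) : Prop := IsPolyhedralSet (epigraph φ)

/-- A polyhedral multifunction: its graph is a union of finitely many polyhedral convex sets. -/
def IsPolyhedralMap (Ψ : E → Set F) : Prop :=
  ∃ (n : ℕ) (P : Fin n → Set (E × F)), (∀ k, IsPolyhedralSet (P k)) ∧
    {p : E × F | p.2 ∈ Ψ p.1} = ⋃ k, P k

/-- The constraint qualification for minimizing `f(x) + g(A x)`: one of
`0 ∈ ri (dom g - A dom f)`; `g` is polyhedral and `dom g ∩ A ri dom f ≠ ∅`;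
`f` and `g` are polyhedral and `dom g ∩ A dom f ≠ ∅`. -/
def ConstraintQualification (f : E → EReal) (g : F → EReal) (A : E →ₗ[ℝ] F) : Prop :=
  (0 : F) ∈ intrinsicInterior ℝ (effDom g - A '' effDom f) ∨
  (IsPolyhedralFun g ∧ (effDom g ∩ A '' intrinsicInterior ℝ (effDom f)).Nonempty) ∨
  (IsPolyhedralFun f ∧ IsPolyhedralFun g ∧ (effDom g ∩ A '' effDom f).Nonempty)

end Polyhedral

section Block

variable {I J : Type*} [Fintype I] [Fintype J]
  {X : I → Type*} [∀ i, NormedAddCommGroup (X i)] [∀ i, InnerProductSpace ℝ (X i)]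
  {Y : J → Type*} [∀ j, NormedAddCommGroup (Y j)] [∀ j, InnerProductSpace ℝ (Y j)]

/-- The separable function `x ↦ ∑ i, φ i (x i)` on the Euclidean product of the `X i`. -/
def sepSum (φ : ∀ i, X i → EReal) (x : PiLp 2 X) : EReal := ∑ i, φ i (x i)

/-- The linear map `A x = (∑ i, A j i (x i))_j` with blocks `A j i`. -/
def blockMap (A : ∀ j i, X i →ₗ[ℝ] Y j) : PiLp 2 X →ₗ[ℝ] PiLp 2 Y where
  toFun x := WithLp.toLp 2 fun j => ∑ i, A j i (x i)
  map_add' x y := by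
    ext j
    simp [Finset.sum_add_distrib]
  map_smul' c x := by
    ext j
    simp [Finset.smul_sum]

/-- The primal objective `F(x) = ∑ i, f i (x i) + ∑ j, g j (A_j x)`. -/
def primalObj (f : ∀ i, X i → EReal) (g : ∀ j, Y j → EReal) (A : ∀ j i, X i →ₗ[ℝ] Y j)
    (x : PiLp 2 X) : EReal :=
  (∑ i, f i (x i)) + ∑ j, g j (blockMap A x j)

/-- The dual objective `D(y) = ∑ i, f_i*(-∑ j, A_{ji}* y_j) + ∑ j, g_j*(y_j)`. -/
def dualObj [∀ i, FiniteDimensional ℝ (X i)] [∀ j, FiniteDimensional ℝ (Y j)]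
    (f : ∀ i, X i → EReal) (g : ∀ j, Y j → EReal) (A : ∀ j i, X i →ₗ[ℝ] Y j)
    (y : PiLp 2 Y) : EReal :=
  (∑ i, conjugate (f i) (-∑ j, (A j i).adjoint (y j))) + ∑ j, conjugate (g j) (y j)

end Block

end CompositeDual

end

open CompositeDual

/-!
The primal solution `x` turns the dual problem into a set of blockwise conditions. By the optimality
condition `0 ∈ ∂f(x) + A* ∂g(A x)` (`exists_subgradient_of_minimizer`) there is a `y` with
`-(A* y)_i ∈ ∂f_i(x_i)` and `y_j ∈ ∂g_j((A x)_j)` for all blocks; such `y` are called certificates.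
Equality in Fenchel–Young makes every certificate a dual minimizer, with dual value the negative of
the primal one, so it suffices to bound the dual objective below by the squared distance to the set
of certificates. Two estimates on balls are combined.

* Growth of each conjugate (`conjugate_growth`): if `∂φ` is upper Lipschitz at `x₀`, then `φ*`
  exceeds its supporting affine function with slope `x₀` by a multiple of the squared distance to
  `∂φ(x₀)`. The supremum defining `φ*(v)` is tested at the proximal point of `x₀ + l v`. Since only
  bounded subgradients occur, a bounded form of the Lipschitz property is enough, and polyhedral
  multifunctions have it (`IsPolyhedralMap.boundedUpperLipschitzAt`). The affine parts cancel in the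
  dual objective, leaving the squared distances of `y` from the blockwise conditions.
* Regularity of the intersection: the distance of `y` to the set of certificates is bounded by the
  sum of its distances from the blockwise conditions. In the polyhedral case this is Hoffman's error
  bound over the finitely many choices of polyhedral pieces (`exists_infDist_iInter_le`); choices
  whose pieces do not meet are harmless on a ball, where their total violation is bounded away from
  zero. Under the relative interior condition a nearly feasible point is made feasible by mixing in
  a small bounded correction (`exists_infDist_le_of_mem_intrinsicInterior`).

The optimality condition comes from a Lagrange multiplier for the coupled epigraphs: from the Riesz
extension theorem under the relative interior qualification, from the affine Farkas lemma when both
functions are polyhedral, and from both in the mixed case. Farkas' lemma and Hoffman's bound rest on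
Carathéodory's theorem for finitely generated cones, which also bounds the coefficients of a vector
in such a cone by its norm.
-/

namespace CompositeDual

/-! ### Finitely generated cones and Farkas' lemma -/

section Cones

variable {V : Type*} [NormedAddCommGroup V] [NormedSpace ℝ V] {ι : Type*}

/-- Carathéodory's theorem for finitely generated cones. -/
theorem exists_linearIndepOn_nonneg_combination (a : ι → V) (s : Finset ι) (l : ι → ℝ)
    (hl : ∀ i ∈ s, 0 ≤ l i) :
    ∃ t ⊆ s, LinearIndepOn ℝ a (t : Set ι) ∧ ∃ m : ι → ℝ, (∀ i ∈ t, 0 ≤ m i) ∧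
      ∑ i ∈ t, m i • a i = ∑ i ∈ s, l i • a i := by
  classical
  induction s using Finset.strongInduction generalizing l with
  | H s ih =>
    by_cases hind : LinearIndepOn ℝ a (s : Set ι)
    · exact ⟨s, subset_rfl, hind, l, hl, rfl⟩
    obtain ⟨g, hg0, i₀, hi₀, hgi₀⟩ : ∃ g : ι → ℝ, ∑ i ∈ s, g i • a i = 0 ∧ ∃ i ∈ s, 0 < g i := by
      rw [linearIndepOn_finset_iff] at hind
      push Not at hind
      obtain ⟨g, hg, i, hi, hne⟩ := hind
      rcases lt_or_gt_of_ne hne with h | h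
      · exact ⟨fun j => -g j, by simp [hg], i, hi, by simpa using h⟩
      · exact ⟨g, hg, i, hi, h⟩
    -- the largest step along `-g` that keeps all coefficients nonnegative kills one of them
    obtain ⟨k, hk, hmin⟩ := (s.filter fun i => 0 < g i).exists_min_image (fun i => l i / g i)
      ⟨i₀, by simp [hi₀, hgi₀]⟩
    simp only [Finset.mem_filter] at hk hmin
    obtain ⟨hks, hgk⟩ := hk
    set θ := l k / g k with hθ
    have hθ0 : 0 ≤ θ := div_nonneg (hl k hks) hgk.le
    obtain ⟨t, hts, hti, m, hm, hsum⟩ := ih (s.erase k) (Finset.erase_ssubset hks)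
      (fun i => l i - θ * g i) (by
        intro i hi
        have his := Finset.mem_of_mem_erase hi
        rcases lt_or_ge 0 (g i) with h | h
        · have := hmin i ⟨his, h⟩
          rw [le_div_iff₀ h] at this
          linarith
        · have := hl i his
          nlinarith)
    refine ⟨t, hts.trans (Finset.erase_subset _ _), hti, m, hm, hsum.trans ?_⟩
    have hk0 : (l k - θ * g k) • a k = 0 := by
      rw [hθ, div_mul_cancel₀ _ hgk.ne', sub_self, zero_smul]
    rw [Finset.sum_erase s (f := fun i => (l i - θ * g i) • a i) hk0]
    simp only [sub_smul, Finset.sum_sub_distrib, mul_smul, ← Finset.smul_sum, hg0, smul_zero,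
      sub_zero]

/-- The coefficients of a linearly independent family are controlled by the norm of the
combination. -/
theorem exists_sum_abs_le_of_linearIndepOn (a : ι → V) (t : Finset ι)
    (h : LinearIndepOn ℝ a (t : Set ι)) :
    ∃ c : ℝ, 0 ≤ c ∧ ∀ m : ι → ℝ, ∑ i ∈ t, |m i| ≤ c * ‖∑ i ∈ t, m i • a i‖ := by
  let T : (t → ℝ) →ₗ[ℝ] V := Fintype.linearCombination ℝ (fun i : t => a i)
  have hT : LinearMap.ker T = ⊥ := by
    have h' : LinearIndependent ℝ (fun i : t => a i) := h
    rw [LinearMap.ker_eq_bot]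
    exact h'.fintypeLinearCombination_injective
  obtain ⟨K, -, hK⟩ := T.exists_antilipschitzWith hT
  refine ⟨t.card * K, by positivity, fun m => ?_⟩
  have hTm : T (fun i => m i) = ∑ i ∈ t, m i • a i := by
    rw [← Finset.sum_coe_sort t (fun i => m i • a i)]
    simp [T, Fintype.linearCombination_apply]
  have h1 : ∀ i ∈ t, |m i| ≤ K * ‖∑ i ∈ t, m i • a i‖ := by
    intro i hi
    have h2 := hK.le_mul_norm (map_zero T) (fun i : t => m i)
    rw [hTm] at h2
    exact (norm_le_pi_norm (fun i : t => m i) ⟨i, hi⟩).trans h2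
  calc ∑ i ∈ t, |m i| ≤ ∑ _i ∈ t, K * ‖∑ i ∈ t, m i • a i‖ := Finset.sum_le_sum h1
    _ = t.card * K * ‖∑ i ∈ t, m i • a i‖ := by simp [mul_assoc]

/-- Elements of a finitely generated cone have nonnegative coefficients bounded by their norm,
with a constant that serves all subfamilies of the generators. -/
theorem exists_bounded_coefficients (a : ι → V) (s : Finset ι) :
    ∃ c : ℝ, 0 ≤ c ∧ ∀ s' ⊆ s, ∀ l : ι → ℝ, (∀ i ∈ s', 0 ≤ l i) →
      ∃ m : ι → ℝ, (∀ i, 0 ≤ m i) ∧ (∀ i ∉ s', m i = 0) ∧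
        ∑ i ∈ s, m i • a i = ∑ i ∈ s', l i • a i ∧
        ∑ i ∈ s, m i ≤ c * ‖∑ i ∈ s', l i • a i‖ := by
  classical
  have hex : ∀ t : Finset ι, ∃ c : ℝ, 0 ≤ c ∧ (LinearIndepOn ℝ a (t : Set ι) →
      ∀ m : ι → ℝ, ∑ i ∈ t, |m i| ≤ c * ‖∑ i ∈ t, m i • a i‖) := by
    intro t
    by_cases h : LinearIndepOn ℝ a (t : Set ι)
    · obtain ⟨c, hc, hcm⟩ := exists_sum_abs_le_of_linearIndepOn a t h
      exact ⟨c, hc, fun _ => hcm⟩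
    · exact ⟨0, le_rfl, fun h' => absurd h' h⟩
  choose c hc0 hc using hex
  refine ⟨∑ t ∈ s.powerset, c t, Finset.sum_nonneg fun t _ => hc0 t, ?_⟩
  intro s' hs' l hl
  obtain ⟨t, hts, hti, m, hm, hsum⟩ := exists_linearIndepOn_nonneg_combination a s' l hl
  have hts' := hts.trans hs'
  refine ⟨fun i => if i ∈ t then m i else 0, ?_, ?_, ?_, ?_⟩
  · intro i
    by_cases hi : i ∈ t <;> simp [hi, hm]
  · intro i hi
    have : i ∉ t := fun h => hi (hts h)
    simp [this]
  · rw [← hsum, ← Finset.sum_subset hts' (fun i _ hi => by simp [hi])]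
    exact Finset.sum_congr rfl fun i hi => by simp [hi]
  · rw [← Finset.sum_subset hts' (fun i _ hi => by simp [hi]), ← hsum]
    calc ∑ i ∈ t, (if i ∈ t then m i else 0) ≤ ∑ i ∈ t, |m i| :=
          Finset.sum_le_sum fun i hi => by simp [hi, le_abs_self]
      _ ≤ c t * ‖∑ i ∈ t, m i • a i‖ := hc t hti m
      _ ≤ _ := by
          gcongr
          exact Finset.single_le_sum (fun t _ => hc0 t) (Finset.mem_powerset.2 hts')

/-- The convex cone generated by the `a i`, `i ∈ s`. -/
def finCone (a : ι → V) (s : Finset ι) : Set V :=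
  {x | ∃ l : ι → ℝ, (∀ i, 0 ≤ l i) ∧ ∑ i ∈ s, l i • a i = x}

theorem convex_finCone (a : ι → V) (s : Finset ι) : Convex ℝ (finCone a s) := by
  rintro _ ⟨l, hl, rfl⟩ _ ⟨m, hm, rfl⟩ p q hp hq -
  refine ⟨fun i => p * l i + q * m i, fun i => ?_, ?_⟩
  · have := hl i
    have := hm i
    positivity
  · simp [add_smul, Finset.sum_add_distrib, Finset.smul_sum, mul_smul]

theorem isClosed_finCone (a : ι → V) (s : Finset ι) : IsClosed (finCone a s) := by
  obtain ⟨c, hc, hbd⟩ := exists_bounded_coefficients a s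
  refine isClosed_of_closure_subset fun x hx => ?_
  set R := c * (‖x‖ + 1)
  -- near `x` the coefficients range over a compact box
  let Φ : (s → ℝ) → V := fun m => ∑ i : s, m i • a i
  have hcont : Continuous Φ := by fun_prop
  have hcomp : IsCompact (Φ '' Set.Icc 0 (fun _ => R)) :=
    isCompact_Icc.image hcont
  have hsub : x ∈ closure (Φ '' Set.Icc 0 (fun _ => R)) := by
    rw [Metric.mem_closure_iff] at hx ⊢
    intro ε hε
    obtain ⟨y, ⟨l, hl, rfl⟩, hxy⟩ := hx (min ε 1) (by positivity)
    refine ⟨_, ?_, hxy.trans_le (min_le_left _ _)⟩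
    obtain ⟨m, hm, -, hsum, hle⟩ := hbd s subset_rfl l (fun i _ => hl i)
    refine ⟨fun i => m i, ⟨fun i => hm i, fun i => ?_⟩, ?_⟩
    · have h1 : m i ≤ ∑ i ∈ s, m i := Finset.single_le_sum (fun j _ => hm j) i.2
      refine h1.trans (hle.trans ?_)
      have h2 : ‖∑ i ∈ s, l i • a i‖ ≤ ‖x‖ + 1 := by
        have := norm_le_norm_add_norm_sub' (∑ i ∈ s, l i • a i) x
        rw [dist_eq_norm, norm_sub_rev] at hxy
        have h3 := hxy.le.trans (min_le_right _ _)
        rw [norm_sub_rev] at this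
        rw [norm_sub_rev] at h3
        linarith
      exact mul_le_mul_of_nonneg_left h2 hc
    · rw [← hsum, ← Finset.sum_coe_sort s (fun i => m i • a i)]
  rw [hcomp.isClosed.closure_eq] at hsub
  obtain ⟨m, hm, rfl⟩ := hsub
  classical
  refine ⟨fun i => if h : i ∈ s then m ⟨i, h⟩ else 0, fun i => ?_, ?_⟩
  · by_cases h : i ∈ s
    · simpa [h] using hm.1 ⟨i, h⟩
    · simp [h]
  · rw [← Finset.sum_coe_sort s]
    simp [Φ]

end Cones

section Farkas

/-- **Farkas' lemma** in a Euclidean space. -/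
theorem farkas_inner {V : Type*} [NormedAddCommGroup V] [InnerProductSpace ℝ V]
    [FiniteDimensional ℝ V] {ι : Type*} (a : ι → V) (s : Finset ι) (c : V)
    (h : ∀ u : V, (∀ i ∈ s, ⟪a i, u⟫_ℝ ≤ 0) → ⟪c, u⟫_ℝ ≤ 0) :
    c ∈ finCone a s := by
  classical
  by_contra hc
  obtain ⟨f, u, hfu, hu⟩ := geometric_hahn_banach_closed_point (convex_finCone a s)
    (isClosed_finCone a s) hc
  set v := (InnerProductSpace.toDual ℝ V).symm f with hv
  have hfv : ∀ x, f x = ⟪x, v⟫_ℝ := fun x => by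
    rw [real_inner_comm, hv, InnerProductSpace.toDual_symm_apply]
  have hu0 : 0 < u := by
    simpa using hfu 0 ⟨0, by simp, by simp⟩
  have := h v (fun i hi => by
    by_contra! hpos
    have := hfu ((u / ⟪a i, v⟫_ℝ) • a i) ⟨Pi.single i (u / ⟪a i, v⟫_ℝ), fun j => by
      by_cases hj : j = i
      · subst hj; simp; positivity
      · simp [hj], by
      rw [Finset.sum_eq_single i (fun j _ hj => by simp [hj]) (fun h' => absurd hi h')]
      simp⟩
    rw [hfv, inner_smul_left] at this
    simp [hpos.ne'] at this)
  rw [hfv] at hu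
  linarith

/-- **Farkas' lemma** for linear functionals on a finite-dimensional space. -/
theorem farkas_dual {V : Type*} [AddCommGroup V] [Module ℝ V] [FiniteDimensional ℝ V]
    {ι : Type*} (a : ι → Module.Dual ℝ V) (s : Finset ι) (c : Module.Dual ℝ V)
    (h : ∀ u : V, (∀ i ∈ s, a i u ≤ 0) → c u ≤ 0) :
    ∃ l : ι → ℝ, (∀ i, 0 ≤ l i) ∧ ∀ u, ∑ i ∈ s, l i * a i u = c u := by
  let e : V ≃ₗ[ℝ] EuclideanSpace ℝ (Fin (Module.finrank ℝ V)) :=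
    LinearEquiv.ofFinrankEq _ _ (by simp)
  let ρ : Module.Dual ℝ V → EuclideanSpace ℝ (Fin (Module.finrank ℝ V)) := fun φ =>
    (InnerProductSpace.toDual ℝ _).symm (LinearMap.toContinuousLinearMap (φ ∘ₗ e.symm.toLinearMap))
  have hρ : ∀ φ u, ⟪ρ φ, u⟫_ℝ = φ (e.symm u) := fun φ u => by
    simp [ρ, InnerProductSpace.toDual_symm_apply]
  obtain ⟨l, hl, hsum⟩ := farkas_inner (fun i => ρ (a i)) s (ρ c) (fun u hu => by
    rw [hρ]
    exact h _ fun i hi => by rw [← hρ]; exact hu i hi)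
  refine ⟨l, hl, fun u => ?_⟩
  have := congrArg (fun w => ⟪w, e u⟫_ℝ) hsum
  simpa [sum_inner, inner_smul_left, hρ] using this

/-- The affine form of Farkas' lemma: a linear inequality valid on a nonempty polyhedron is a
nonnegative combination of the defining ones. -/
theorem farkas_affine {V : Type*} [AddCommGroup V] [Module ℝ V] [FiniteDimensional ℝ V]
    {ι : Type*} (a : ι → Module.Dual ℝ V) (b : ι → ℝ) (s : Finset ι) (c : Module.Dual ℝ V)
    (d : ℝ) (hne : ∃ u, ∀ i ∈ s, a i u ≤ b i) (h : ∀ u, (∀ i ∈ s, a i u ≤ b i) → c u ≤ d) :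
    ∃ l : ι → ℝ, (∀ i, 0 ≤ l i) ∧ (∀ u, ∑ i ∈ s, l i * a i u = c u) ∧
      ∑ i ∈ s, l i * b i ≤ d := by
  obtain ⟨u₀, hu₀⟩ := hne
  -- homogenize: the point `u` becomes the ray through `(u, -1)`
  let α : Option ι → Module.Dual ℝ (V × ℝ) := fun o =>
    o.elim (LinearMap.snd ℝ V ℝ) fun i => (a i).coprod ((b i) • LinearMap.id)
  obtain ⟨l, hl, hsum⟩ := farkas_dual α s.insertNone (c.coprod (d • LinearMap.id)) (by
    rintro ⟨u, t⟩ hu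
    have ht : t ≤ 0 := hu none (by simp)
    have hi : ∀ i ∈ s, a i u + b i * t ≤ 0 := fun i hi => by
      simpa [α] using hu (some i) (by simpa using hi)
    have goal : c u + d * t ≤ 0 := by
      rcases ht.lt_or_eq with ht | rfl
      · have := h ((-t)⁻¹ • u) (fun i his => by
          have h1 := hi i his
          rw [map_smul, smul_eq_mul, inv_mul_le_iff₀ (by linarith)]
          linarith)
        rw [map_smul, smul_eq_mul, inv_mul_le_iff₀ (by linarith)] at this
        linarith
      · simp only [mul_zero, add_zero] at hi ⊢
        by_contra! hpos
        set τ := (|d - c u₀| + 1) / c u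
        have hτ : 0 ≤ τ := by positivity
        have := h (u₀ + τ • u) (fun i his => by
          have h1 := hi i his
          have h2 := hu₀ i his
          rw [map_add, map_smul, smul_eq_mul]
          nlinarith)
        rw [map_add, map_smul, smul_eq_mul, div_mul_cancel₀ _ hpos.ne'] at this
        have := le_abs_self (d - c u₀)
        linarith
    simpa using goal)
  refine ⟨fun i => l (some i), fun i => hl _, fun u => ?_, ?_⟩
  · simpa [α, Finset.sum_insertNone] using hsum (u, 0)
  · have := hsum (0, 1)
    simp [α, Finset.sum_insertNone] at this
    have := hl none
    linarith

/-- A linear functional that is at least `m` on the part of a polyhedron lying in the flat `w₀ + W`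
can be tilted by a functional vanishing on `W` so that the bound holds on the whole polyhedron. -/
theorem exists_multiplier_of_polyhedral {V : Type*} [AddCommGroup V] [Module ℝ V]
    [FiniteDimensional ℝ V] {P : Set V} (hP : IsPolyhedralSet P) (W : Submodule ℝ V) (w₀ : V)
    (hne : ∃ w ∈ P, w - w₀ ∈ W) (l : Module.Dual ℝ V) (m : ℝ)
    (h : ∀ w ∈ P, w - w₀ ∈ W → m ≤ l w) :
    ∃ n : Module.Dual ℝ V, (∀ w ∈ W, n w = 0) ∧ ∀ w ∈ P, m ≤ l w - n (w - w₀) := by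
  obtain ⟨N, a, b, rfl⟩ := hP
  obtain ⟨μ, hμ, hsum, hle⟩ := farkas_affine (V := W) (fun k => (a k) ∘ₗ W.subtype)
    (fun k => b k - a k w₀) Finset.univ (-(l ∘ₗ W.subtype)) (l w₀ - m)
    (by
      obtain ⟨w, hw, hwW⟩ := hne
      refine ⟨⟨w - w₀, hwW⟩, fun k _ => ?_⟩
      simpa using hw k)
    (by
      intro u hu
      have := h (u + w₀) (fun k => by
        have := hu k (Finset.mem_univ k)
        simp at this
        rw [map_add]
        linarith) (by simp)
      rw [map_add] at this
      simp
      linarith)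
  refine ⟨l + ∑ k, μ k • a k, fun w hw => ?_, fun w hw => ?_⟩
  · have := hsum ⟨w, hw⟩
    simp at this
    simp [this]
  · have h1 : ∑ k, μ k * (a k w - a k w₀) ≤ ∑ k, μ k * (b k - a k w₀) :=
      Finset.sum_le_sum fun k _ => mul_le_mul_of_nonneg_left (by linarith [hw k]) (hμ k)
    simp [mul_sub, Finset.sum_sub_distrib] at h1 hle ⊢
    linarith

end Farkas

/-! ### Hoffman's error bound -/

section Hoffman

variable {V : Type*} [NormedAddCommGroup V] [InnerProductSpace ℝ V]

/-- A minimal-distance point of a closed convex set, with its variational inequality. -/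
theorem exists_projection [FiniteDimensional ℝ V] {C : Set V} (hne : C.Nonempty)
    (hcl : IsClosed C) (hconv : Convex ℝ C) (u : V) :
    ∃ p ∈ C, ‖u - p‖ = Metric.infDist u C ∧ ∀ w ∈ C, ⟪u - p, w - p⟫_ℝ ≤ 0 := by
  obtain ⟨p, hp, hd⟩ := hcl.exists_infDist_eq_dist hne u
  rw [dist_eq_norm] at hd
  refine ⟨p, hp, hd.symm, (norm_eq_iInf_iff_real_inner_le_zero hconv hp).1 ?_⟩
  rw [← hd, Metric.infDist_eq_iInf]
  simp [dist_eq_norm]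

/-- The polyhedron defined by the inequalities `⟪c, y⟫ ≤ b`, `(c, b) ∈ s`. -/
def polyhedron (s : Finset (V × ℝ)) : Set V := {y | ∀ c ∈ s, ⟪c.1, y⟫_ℝ ≤ c.2}

theorem isClosed_polyhedron (s : Finset (V × ℝ)) : IsClosed (polyhedron s) := by
  have : polyhedron s = ⋂ c ∈ s, {y | ⟪c.1, y⟫_ℝ ≤ c.2} := by
    ext y
    simp [polyhedron]
  rw [this]
  exact isClosed_biInter fun c _ => isClosed_le (by fun_prop) continuous_const

theorem convex_polyhedron (s : Finset (V × ℝ)) : Convex ℝ (polyhedron s) := by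
  intro x hx y hy p q hp hq hpq c hc
  have h1 := mul_le_mul_of_nonneg_left (hx c hc) hp
  have h2 := mul_le_mul_of_nonneg_left (hy c hc) hq
  rw [inner_add_right, inner_smul_right, inner_smul_right]
  calc _ ≤ p * c.2 + q * c.2 := add_le_add h1 h2
    _ = c.2 := by rw [← add_mul, hpq, one_mul]

variable [FiniteDimensional ℝ V]

/-- **Hoffman's error bound**: the distance to a nonempty polyhedron is controlled by the largest
constraint violation. The residual `y - p` of the projection lies in the cone of the constraints
active at `p`, and its coefficients in that cone can be bounded by `‖y - p‖`. -/
theorem exists_hoffman_bound (s : Finset (V × ℝ)) (hne : (polyhedron s).Nonempty) :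
    ∃ H : ℝ, 0 ≤ H ∧ ∀ y, ∀ ε : ℝ, 0 ≤ ε → (∀ c ∈ s, ⟪c.1, y⟫_ℝ - c.2 ≤ ε) →
      Metric.infDist y (polyhedron s) ≤ H * ε := by
  classical
  obtain ⟨H, hH, hbd⟩ := exists_bounded_coefficients (V := V) Prod.fst s
  refine ⟨H, hH, fun y ε hε hy => ?_⟩
  obtain ⟨p, hp, hd, hvar⟩ := exists_projection hne (isClosed_polyhedron s)
    (convex_polyhedron s) y
  rw [← hd]
  set s' := s.filter fun c => ⟪c.1, p⟫_ℝ = c.2 with hs'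
  have hss : s' ⊆ s := Finset.filter_subset _ _
  have hcone : y - p ∈ finCone Prod.fst s' := by
    refine farkas_inner _ _ _ fun u hu => ?_
    -- a direction pointing out of no active constraint can be followed for a short while
    have hev : ∀ᶠ t in nhdsWithin (0 : ℝ) (Set.Ioi 0), ∀ c ∈ s, ⟪c.1, p + t • u⟫_ℝ ≤ c.2 := by
      rw [Finset.eventually_all]
      intro c hc
      by_cases hact : ⟪c.1, p⟫_ℝ = c.2
      · filter_upwards [self_mem_nhdsWithin] with t ht
        have h1 := hu c (by simp [hs', hc, hact])
        have h2 : 0 < t := ht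
        rw [inner_add_right, inner_smul_right, hact]
        nlinarith
      · have hlt := lt_of_le_of_ne (hp c hc) hact
        have hcont : Continuous fun t : ℝ => ⟪c.1, p + t • u⟫_ℝ := by fun_prop
        have : ∀ᶠ t in nhds (0 : ℝ), ⟪c.1, p + t • u⟫_ℝ < c.2 :=
          hcont.continuousAt.eventually_lt continuousAt_const (by simpa using hlt)
        exact (this.filter_mono nhdsWithin_le_nhds).mono fun t ht => ht.le
    obtain ⟨t, ht, ht0⟩ := (hev.and self_mem_nhdsWithin).exists
    have := hvar _ ht
    rw [add_sub_cancel_left, inner_smul_right] at this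
    exact nonpos_of_mul_nonpos_right this ht0
  obtain ⟨l, hl, hlsum⟩ := hcone
  obtain ⟨m, hm, hm0, hsum, hle⟩ := hbd s' hss l fun i _ => hl i
  rw [hlsum] at hsum hle
  have hsq : ‖y - p‖ ^ 2 ≤ (H * ε) * ‖y - p‖ := by
    calc ‖y - p‖ ^ 2 = ⟪∑ c ∈ s, m c • c.1, y - p⟫_ℝ := by
          rw [hsum, real_inner_self_eq_norm_sq]
      _ = ∑ c ∈ s, m c * ⟪c.1, y - p⟫_ℝ := by simp [sum_inner, inner_smul_left]
      _ ≤ ∑ c ∈ s, m c * ε := by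
          refine Finset.sum_le_sum fun c hc => ?_
          by_cases hcs : c ∈ s'
          · have h1 : ⟪c.1, p⟫_ℝ = c.2 := (Finset.mem_filter.1 hcs).2
            rw [inner_sub_right, h1]
            exact mul_le_mul_of_nonneg_left (hy c hc) (hm c)
          · simp [hm0 c hcs]
      _ = (∑ c ∈ s, m c) * ε := by rw [Finset.sum_mul]
      _ ≤ (H * ‖y - p‖) * ε := mul_le_mul_of_nonneg_right hle hε
      _ = _ := by ring
  rcases (norm_nonneg (y - p)).eq_or_lt with h0 | h0
  · rw [← h0]
    positivity
  · rw [sq] at hsq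
    exact le_of_mul_le_mul_right hsq h0

/-- A form of Hoffman's bound on balls that also covers infeasible systems: on a ball the violation
of an infeasible system is bounded away from zero, so it controls the distance to any nonempty
set. -/
theorem exists_local_hoffman_bound (s : Finset (V × ℝ)) {T : Set V} (hsT : polyhedron s ⊆ T)
    (hT : T.Nonempty) (r : ℝ) :
    ∃ H : ℝ, 0 ≤ H ∧ ∀ y, ‖y‖ ≤ r → ∀ ε : ℝ, 0 ≤ ε → (∀ c ∈ s, ⟪c.1, y⟫_ℝ - c.2 ≤ ε) →
      Metric.infDist y T ≤ H * ε := by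
  classical
  rcases (polyhedron s).eq_empty_or_nonempty with hemp | hne
  · obtain ⟨t₀, ht₀⟩ := hT
    rcases lt_or_ge r 0 with hr | hr
    · exact ⟨0, le_rfl, fun y hy => absurd (norm_nonneg y) (by linarith)⟩
    let φ : V → ℝ := fun y => ∑ c ∈ s, max (⟪c.1, y⟫_ℝ - c.2) 0
    have hφ : Continuous φ := by fun_prop
    obtain ⟨y₀, -, hmin⟩ := (isCompact_closedBall (0 : V) r).exists_isMinOn
      ⟨0, by simpa using hr⟩ hφ.continuousOn
    have hpos : 0 < φ y₀ := by
      have : ∃ c ∈ s, c.2 < ⟪c.1, y₀⟫_ℝ := by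
        by_contra! hcon
        exact (hemp ▸ (show y₀ ∈ polyhedron s from hcon) : y₀ ∈ (∅ : Set V))
      obtain ⟨c, hc, hlt⟩ := this
      exact Finset.sum_pos' (fun _ _ => le_max_right _ _)
        ⟨c, hc, lt_max_of_lt_left (by linarith)⟩
    refine ⟨(r + ‖t₀‖) * s.card / φ y₀, by positivity, fun y hy ε hε hres => ?_⟩
    have h1 : φ y₀ ≤ s.card * ε := by
      calc φ y₀ ≤ φ y := hmin (by simpa using hy)
        _ ≤ ∑ _c ∈ s, ε := Finset.sum_le_sum fun c hc => max_le (hres c hc) hε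
        _ = s.card * ε := by simp
    calc Metric.infDist y T ≤ dist y t₀ := Metric.infDist_le_dist_of_mem ht₀
      _ ≤ ‖y‖ + ‖t₀‖ := dist_le_norm_add_norm _ _
      _ ≤ r + ‖t₀‖ := by gcongr
      _ ≤ (r + ‖t₀‖) * (s.card * ε / φ y₀) :=
          le_mul_of_one_le_right (by positivity) ((one_le_div hpos).2 h1)
      _ = _ := by ring
  · obtain ⟨H, hH, hbd⟩ := exists_hoffman_bound s hne
    exact ⟨H, hH, fun y _ ε hε hres =>
      (Metric.infDist_le_infDist_of_subset hsT hne).trans (hbd y ε hε hres)⟩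

/-- `S` contains finitely many polyhedra such that, at any given point `y`, one of them has all its
constraints violated by at most a fixed multiple of `ρ y`. For a finite union of polyhedra the
pieces can be taken to be the members of the union, and `ρ` the distance to the union. -/
def HasPolyhedralPieces (S : Set V) (ρ : V → ℝ) : Prop :=
  ∃ (n : ℕ) (s : Fin n → Finset (V × ℝ)) (M : ℝ), 0 ≤ M ∧ (∀ l, polyhedron (s l) ⊆ S) ∧
    ∀ y, ∃ l, ∀ c ∈ s l, ⟪c.1, y⟫_ℝ - c.2 ≤ M * ρ y

/-- Regularity on balls of a finite family of finite unions of polyhedra. -/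
theorem exists_infDist_iInter_le {K : Type*} [Finite K] (S : K → Set V) (ρ : V → ℝ)
    (hρ : ∀ y, 0 ≤ ρ y) (h : ∀ k, HasPolyhedralPieces (S k) ρ) (hne : (⋂ k, S k).Nonempty)
    (r : ℝ) :
    ∃ H : ℝ, 0 ≤ H ∧ ∀ y, ‖y‖ ≤ r → Metric.infDist y (⋂ k, S k) ≤ H * ρ y := by
  classical
  cases nonempty_fintype K
  choose n s M hM hs hρs using h
  have hsub : ∀ κ : ∀ k, Fin (n k),
      polyhedron (Finset.univ.biUnion fun k => s k (κ k)) ⊆ ⋂ k, S k := by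
    intro κ y hy
    refine Set.mem_iInter.2 fun k => hs k (κ k) fun c hc => hy c ?_
    exact Finset.mem_biUnion.2 ⟨k, Finset.mem_univ k, hc⟩
  choose H hH hbd using fun κ => exists_local_hoffman_bound _ (hsub κ) hne r
  have hMs : 0 ≤ ∑ k, M k := Finset.sum_nonneg fun k _ => hM k
  refine ⟨(∑ κ, H κ) * ∑ k, M k, mul_nonneg (Finset.sum_nonneg fun κ _ => hH κ) hMs,
    fun y hy => ?_⟩
  choose κ hκ using fun k => hρs k y
  refine (hbd κ y hy ((∑ k, M k) * ρ y) (mul_nonneg hMs (hρ y)) ?_).trans ?_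
  · intro c hc
    obtain ⟨k, -, hk⟩ := Finset.mem_biUnion.1 hc
    exact (hκ k c hk).trans (mul_le_mul_of_nonneg_right
      (Finset.single_le_sum (fun k _ => hM k) (Finset.mem_univ k)) (hρ y))
  · rw [mul_assoc]
    exact mul_le_mul_of_nonneg_right
      (Finset.single_le_sum (fun κ _ => hH κ) (Finset.mem_univ κ)) (mul_nonneg hMs (hρ y))

end Hoffman

/-! ### Lagrange multipliers for convex epigraphs -/

section Duality

/-- A point of the relative interior can be moved a little in every direction of the affine
hull. -/
theorem exists_ball_of_mem_intrinsicInterior {V : Type*} [NormedAddCommGroup V] [NormedSpace ℝ V]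
    {S : Set V} {x₀ : V} (h : x₀ ∈ intrinsicInterior ℝ S) :
    ∃ ε > (0 : ℝ), ∀ v ∈ vectorSpan ℝ S, ‖v‖ < ε → x₀ + v ∈ S := by
  rw [mem_intrinsicInterior] at h
  obtain ⟨⟨x, hx⟩, hmem, rfl⟩ := h
  rw [mem_interior_iff_mem_nhds, Metric.mem_nhds_iff] at hmem
  obtain ⟨ε, hε, hball⟩ := hmem
  refine ⟨ε, hε, fun v hv hvε => ?_⟩
  have hxv : x + v ∈ affineSpan ℝ S := by
    have := AffineSubspace.vadd_mem_of_mem_direction (s := affineSpan ℝ S)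
      (by rwa [direction_affineSpan]) hx (v := v)
    rwa [vadd_eq_add, add_comm] at this
  exact hball (show (⟨x + v, hxv⟩ : affineSpan ℝ S) ∈ Metric.ball ⟨x, hx⟩ ε by
    rw [Metric.mem_ball, Subtype.dist_eq]
    simpa using hvε)

theorem exists_smul_of_mem_intrinsicInterior {V : Type*} [NormedAddCommGroup V] [NormedSpace ℝ V]
    {S : Set V} {x₀ : V} (h : x₀ ∈ intrinsicInterior ℝ S) {v : V} (hv : v ∈ vectorSpan ℝ S) :
    ∃ c > (0 : ℝ), x₀ + c • v ∈ S := by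
  obtain ⟨ε, hε, hS⟩ := exists_ball_of_mem_intrinsicInterior h
  refine ⟨ε / (‖v‖ + 1), by positivity, hS _ (Submodule.smul_mem _ _ hv) ?_⟩
  rw [norm_smul, Real.norm_of_nonneg (by positivity), div_mul_eq_mul_div,
    div_lt_iff₀ (by positivity)]
  nlinarith [norm_nonneg v]

variable {E F : Type*} [NormedAddCommGroup E] [InnerProductSpace ℝ E]
  [NormedAddCommGroup F] [InnerProductSpace ℝ F] [FiniteDimensional ℝ F]

/-- If the differences `z - A x` of admissible points fill a neighbourhood of `0` in a subspace
`L`, the value `p` of the coupled problem is supported by an affine function of `z - A x`. The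
multiplier comes from extending `(0, t) ↦ t` from the vertical axis to a functional nonnegative on
the cone of feasible directions at `(0, p)`. -/
theorem exists_multiplier_of_absorbing (A : E →ₗ[ℝ] F) {P : Set (E × ℝ)} {Q : Set (F × ℝ)}
    (hP : Convex ℝ P) (hQ : Convex ℝ Q) (p : ℝ)
    (hp : ∀ x s t, (x, s) ∈ P → (A x, t) ∈ Q → p ≤ s + t)
    (hatt : ∃ a ∈ P, ∃ b ∈ Q, b.1 = A a.1 ∧ a.2 + b.2 ≤ p) (L : Submodule ℝ F)
    (hL : ∀ a ∈ P, ∀ b ∈ Q, b.1 - A a.1 ∈ L)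
    (habs : ∀ u ∈ L, ∃ c > (0 : ℝ), ∃ a ∈ P, ∃ b ∈ Q, b.1 - A a.1 = c • u) :
    ∃ y : F, ∀ a ∈ P, ∀ b ∈ Q, p + ⟪y, b.1 - A a.1⟫_ℝ ≤ a.2 + b.2 := by
  -- directions orthogonal to `L` are added to make the cone absorbing in the whole space
  let S : Set (F × ℝ) := {w | ∃ c > (0 : ℝ), ∃ a ∈ P, ∃ b ∈ Q, ∃ n ∈ Lᗮ,
    b.1 - A a.1 + n = c • w.1 ∧ a.2 + b.2 ≤ p + c * w.2}
  have hS0 : (0 : F × ℝ) ∈ S := by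
    obtain ⟨a, ha, b, hb, hab, hle⟩ := hatt
    exact ⟨1, one_pos, a, ha, b, hb, 0, Submodule.zero_mem _, by simp [hab], by simpa using hle⟩
  let C : ConvexCone ℝ (F × ℝ) :=
    { carrier := S
      smul_mem' := by
        rintro μ hμ w ⟨c, hc, a, ha, b, hb, n, hn, h1, h2⟩
        refine ⟨c / μ, by positivity, a, ha, b, hb, n, hn, ?_, ?_⟩
        · rw [h1, Prod.smul_fst, smul_smul, div_mul_cancel₀ _ hμ.ne']
        · rw [Prod.smul_snd, smul_eq_mul, ← mul_assoc, div_mul_cancel₀ _ hμ.ne']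
          exact h2
      add_mem' := by
        rintro w ⟨c, hc, a, ha, b, hb, n, hn, h1, h2⟩
          w' ⟨c', hc', a', ha', b', hb', n', hn', h1', h2'⟩
        have hcc : 0 < c + c' := by positivity
        have e1 : c' / (c + c') + c / (c + c') = 1 := by field_simp; ring
        refine ⟨c * c' / (c + c'), by positivity, (c' / (c + c')) • a + (c / (c + c')) • a',
          hP ha ha' (by positivity) (by positivity) e1,
          (c' / (c + c')) • b + (c / (c + c')) • b',
          hQ hb hb' (by positivity) (by positivity) e1,
          (c' / (c + c')) • n + (c / (c + c')) • n',
          Submodule.add_mem _ (Submodule.smul_mem _ _ hn) (Submodule.smul_mem _ _ hn'), ?_, ?_⟩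
        · have : (c' / (c + c')) • (b.1 - A a.1 + n) + (c / (c + c')) • (b'.1 - A a'.1 + n') =
              (c * c' / (c + c')) • (w + w').1 := by
            rw [h1, h1', smul_smul, smul_smul, Prod.fst_add, smul_add]
            congr 2 <;> ring
          rw [← this]
          simp only [Prod.fst_add, Prod.smul_fst, map_add, map_smul, smul_add, smul_sub]
          abel
        · have k1 : (c' / (c + c')) * (a.2 + b.2) ≤ (c' / (c + c')) * (p + c * w.2) :=
            mul_le_mul_of_nonneg_left h2 (by positivity)
          have k2 : (c / (c + c')) * (a'.2 + b'.2) ≤ (c / (c + c')) * (p + c' * w'.2) :=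
            mul_le_mul_of_nonneg_left h2' (by positivity)
          have k3 : (c' / (c + c')) * (p + c * w.2) + (c / (c + c')) * (p + c' * w'.2) =
              p + c * c' / (c + c') * (w.2 + w'.2) := by
            have : p = (c' / (c + c') + c / (c + c')) * p := by rw [e1, one_mul]
            nth_rewrite 3 [this]
            ring
          simp only [Prod.snd_add, Prod.smul_snd, smul_eq_mul]
          linarith }
  have hvert : ∀ t : ℝ, ((0 : F), t) ∈ S → 0 ≤ t := by
    rintro t ⟨c, hc, a, ha, b, hb, n, hn, h1, h2⟩
    have hbL := hL a ha b hb
    have hn0 : n = 0 := by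
      have : n ∈ L := by
        have : n = -(b.1 - A a.1) := by
          rw [smul_zero] at h1
          exact (neg_eq_of_add_eq_zero_right h1).symm
        rw [this]
        exact L.neg_mem hbL
      exact (Submodule.orthogonal_disjoint L).le_bot ⟨this, hn⟩ |> fun h => by simpa using h
    rw [hn0, add_zero, smul_zero, sub_eq_zero] at h1
    have := hp a.1 a.2 b.2 ha (by rw [← h1]; exact hb)
    have : 0 ≤ c * t := by simp at h2; linarith
    exact nonneg_of_mul_nonneg_right this hc
  have habs' : ∀ w : F × ℝ, ∃ t : ℝ, (0, t) + w ∈ S := by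
    rintro ⟨u, r⟩
    obtain ⟨l, hl, n, hn, rfl⟩ := L.exists_add_mem_mem_orthogonal (v := u)
    obtain ⟨c, hc, a, ha, b, hb, hab⟩ := habs l hl
    refine ⟨(a.2 + b.2 - p) / c - r, c, hc, a, ha, b, hb, c • n, Submodule.smul_mem _ _ hn, ?_, ?_⟩
    · simp [hab]
    · simp
      field_simp
      linarith
  let f : (F × ℝ) →ₗ.[ℝ] ℝ := ⟨Submodule.prod ⊥ ⊤, LinearMap.snd ℝ F ℝ ∘ₗ Submodule.subtype _⟩
  have hf : ∀ x : f.domain, f x = (x : F × ℝ).2 := fun x => rfl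
  obtain ⟨g, hgf, hgS⟩ := riesz_extension (C.toPointedCone hS0) f
    (by
      rintro ⟨⟨u, t⟩, hu⟩ hx
      obtain rfl : u = 0 := hu.1
      exact hvert t hx)
    (fun w => by
      obtain ⟨t, ht⟩ := habs' w
      exact ⟨⟨(0, t), by simp [f]⟩, ht⟩)
  have hg : ∀ u t, g (u, t) = g (u, 0) + t := fun u t => by
    have h1 := hgf ⟨(0, t), by simp [f]⟩
    rw [hf] at h1
    have h2 : g ((u, 0) + (0, t)) = g (u, 0) + g (0, t) := map_add g _ _
    rw [Prod.mk_add_mk, add_zero, zero_add] at h2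
    rw [h2]
    exact congrArg _ h1
  refine ⟨(InnerProductSpace.toDual ℝ F).symm
    (LinearMap.toContinuousLinearMap (-(g ∘ₗ LinearMap.inl ℝ F ℝ))), fun a ha b hb => ?_⟩
  have h1 := hgS (b.1 - A a.1, a.2 + b.2 - p)
    ⟨1, one_pos, a, ha, b, hb, 0, Submodule.zero_mem _, by simp, by simp⟩
  rw [hg] at h1
  rw [InnerProductSpace.toDual_symm_apply]
  simp only [LinearMap.coe_toContinuousLinearMap', LinearMap.neg_apply, LinearMap.comp_apply,
    LinearMap.inl_apply]
  linarith

/-- The multiplier when `Q` is polyhedral and its domain contains the image of a relative interior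
point `x₀` of the domain of `P`. That domain is mapped into the flat `A x₀ + L`, where `L` is the
image of its direction space. The multiplier of `exists_multiplier_of_absorbing` for the part of `Q`
over the flat is corrected by a vector orthogonal to `L` so as to serve all of `Q`. -/
theorem exists_multiplier_of_polyhedral_right (A : E →ₗ[ℝ] F) {P : Set (E × ℝ)} {Q : Set (F × ℝ)}
    (hP : Convex ℝ P) (hQ : Convex ℝ Q) (hQpoly : IsPolyhedralSet Q) (p : ℝ)
    (hp : ∀ x s t, (x, s) ∈ P → (A x, t) ∈ Q → p ≤ s + t)
    (hatt : ∃ a ∈ P, ∃ b ∈ Q, b.1 = A a.1 ∧ a.2 + b.2 ≤ p)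
    (hri : ∃ x ∈ intrinsicInterior ℝ (Prod.fst '' P), ∃ t, (A x, t) ∈ Q) :
    ∃ y : F, ∀ a ∈ P, ∀ b ∈ Q, p + ⟪y, b.1 - A a.1⟫_ℝ ≤ a.2 + b.2 := by
  obtain ⟨x₀, hx₀, t₀, ht₀⟩ := hri
  have hx₀P := intrinsicInterior_subset hx₀
  set L : Submodule ℝ F := (vectorSpan ℝ (Prod.fst '' P)).map A with hLdef
  have hPL : ∀ a ∈ P, A a.1 - A x₀ ∈ L := fun a ha => by
    rw [← map_sub]
    exact Submodule.mem_map_of_mem (vsub_mem_vectorSpan ℝ (Set.mem_image_of_mem _ ha) hx₀P)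
  let QL : Set (F × ℝ) := {b | b ∈ Q ∧ b.1 - A x₀ ∈ L}
  have hQL : Convex ℝ QL := by
    intro b hb b' hb' c d hc hd hcd
    refine ⟨hQ hb.1 hb'.1 hc hd hcd, ?_⟩
    have : (c • b + d • b').1 - A x₀ = c • (b.1 - A x₀) + d • (b'.1 - A x₀) := by
      have : A x₀ = (c + d) • A x₀ := by rw [hcd, one_smul]
      nth_rewrite 1 [this]
      simp only [Prod.fst_add, Prod.smul_fst, smul_sub, add_smul]
      abel
    rw [this]
    exact L.add_mem (L.smul_mem _ hb.2) (L.smul_mem _ hb'.2)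
  obtain ⟨y, hy⟩ := exists_multiplier_of_absorbing A hP hQL p
    (fun x s t hx ht => hp x s t hx ht.1)
    (by
      obtain ⟨a, ha, b, hb, hab, hle⟩ := hatt
      exact ⟨a, ha, b, ⟨hb, hab ▸ hPL a ha⟩, hab, hle⟩) L
    (fun a ha b hb => by
      have := L.sub_mem hb.2 (hPL a ha)
      rwa [sub_sub_sub_cancel_right] at this)
    (fun u hu => by
      obtain ⟨v, hv, rfl⟩ := hu
      obtain ⟨c, hc, a, ha, hac⟩ := exists_smul_of_mem_intrinsicInterior hx₀
        (Submodule.neg_mem _ hv)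
      refine ⟨c, hc, a, ha, (A x₀, t₀), ⟨ht₀, by simp⟩, ?_⟩
      simp [hac])
  -- `m` separates the two halves of the inequality for `y`
  obtain ⟨a₀, ha₀, -⟩ := hatt
  have hb₀ : (A x₀, t₀) ∈ QL := ⟨ht₀, by simp⟩
  obtain ⟨m, hmQ, hmP⟩ : ∃ m : ℝ, (∀ b ∈ QL, m ≤ b.2 - ⟪y, b.1⟫_ℝ) ∧
      ∀ a ∈ P, p - m ≤ a.2 + ⟪y, A a.1⟫_ℝ := by
    let T : Set ℝ := (fun b : F × ℝ => b.2 - ⟪y, b.1⟫_ℝ) '' QL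
    have hle : ∀ a ∈ P, ∀ b ∈ QL, p - (a.2 + ⟪y, A a.1⟫_ℝ) ≤ b.2 - ⟪y, b.1⟫_ℝ :=
      fun a ha b hb => by
        have := hy a ha b hb
        rw [inner_sub_right] at this
        linarith
    have hbdd : BddBelow T := ⟨p - (a₀.2 + ⟪y, A a₀.1⟫_ℝ), by
      rintro _ ⟨b, hb, rfl⟩
      exact hle a₀ ha₀ b hb⟩
    refine ⟨sInf T, fun b hb => csInf_le hbdd ⟨b, hb, rfl⟩, fun a ha => ?_⟩
    have : p - (a.2 + ⟪y, A a.1⟫_ℝ) ≤ sInf T := le_csInf ⟨_, _, hb₀, rfl⟩ (by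
      rintro _ ⟨b, hb, rfl⟩
      exact hle a ha b hb)
    linarith
  obtain ⟨n, hnW, hn⟩ := exists_multiplier_of_polyhedral hQpoly (L.prod ⊤) (A x₀, t₀)
    ⟨(A x₀, t₀), ht₀, by simp⟩
    (LinearMap.snd ℝ F ℝ - ((innerSL ℝ y).toLinearMap ∘ₗ LinearMap.fst ℝ F ℝ)) m
    (fun b hb hbL => by simpa using hmQ b ⟨hb, hbL.1⟩)
  have hnn : ∀ u t, n (u, t) = n (u, 0) := fun u t => by
    have h1 : n ((u, 0) + (0, t)) = n (u, 0) + n (0, t) := map_add n _ _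
    rw [hnW (0, t) (by simp), Prod.mk_add_mk] at h1
    simpa using h1
  set ν := (InnerProductSpace.toDual ℝ F).symm
    (LinearMap.toContinuousLinearMap (n ∘ₗ LinearMap.inl ℝ F ℝ)) with hν
  have hνn : ∀ u t, n (u, t) = ⟪ν, u⟫_ℝ := fun u t => by
    rw [hnn, hν, InnerProductSpace.toDual_symm_apply]
    rfl
  refine ⟨y + ν, fun a ha b hb => ?_⟩
  have h1 := hn b hb
  have h2 := hmP a ha
  have h3 : ⟪ν, A a.1 - A x₀⟫_ℝ = 0 := by
    rw [← hνn _ 0]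
    exact hnW _ ⟨hPL a ha, trivial⟩
  have h4 : n (b - (A x₀, t₀)) = ⟪ν, b.1 - A x₀⟫_ℝ := hνn _ _
  rw [h4] at h1
  simp only [LinearMap.sub_apply, LinearMap.snd_apply, LinearMap.comp_apply, LinearMap.fst_apply,
    ContinuousLinearMap.coe_coe, innerSL_apply_apply, inner_sub_right, inner_add_left] at h1 h3 ⊢
  linarith

/-- The multiplier when both sets are polyhedral: the constraint `z = A x` cuts a subspace out of
the polyhedron `P × Q`. -/
theorem exists_multiplier_of_polyhedral_both [FiniteDimensional ℝ E] (A : E →ₗ[ℝ] F)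
    {P : Set (E × ℝ)} {Q : Set (F × ℝ)}
    (hP : IsPolyhedralSet P) (hQ : IsPolyhedralSet Q) (p : ℝ)
    (hp : ∀ x s t, (x, s) ∈ P → (A x, t) ∈ Q → p ≤ s + t)
    (hatt : ∃ a ∈ P, ∃ b ∈ Q, b.1 = A a.1 ∧ a.2 + b.2 ≤ p) :
    ∃ y : F, ∀ a ∈ P, ∀ b ∈ Q, p + ⟪y, b.1 - A a.1⟫_ℝ ≤ a.2 + b.2 := by
  let V := (E × ℝ) × (F × ℝ)
  have hPQ : IsPolyhedralSet (P ×ˢ Q : Set V) := by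
    obtain ⟨N, a, b, rfl⟩ := hP
    obtain ⟨M, c, d, rfl⟩ := hQ
    refine ⟨N + M, Fin.append (fun k => a k ∘ₗ LinearMap.fst ℝ _ _)
      (fun k => c k ∘ₗ LinearMap.snd ℝ _ _), Fin.append b d, ?_⟩
    ext ⟨x, z⟩
    simp only [Set.mem_prod, Set.mem_ofPred_eq]
    constructor
    · rintro ⟨h1, h2⟩ k
      refine Fin.addCases (fun k => ?_) (fun k => ?_) k
      · simpa using h1 k
      · simpa using h2 k
    · intro h
      exact ⟨fun k => by simpa using h (Fin.castAdd M k),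
        fun k => by simpa using h (Fin.natAdd N k)⟩
  let D : V →ₗ[ℝ] F := LinearMap.fst ℝ F ℝ ∘ₗ LinearMap.snd ℝ _ _ -
    A ∘ₗ LinearMap.fst ℝ E ℝ ∘ₗ LinearMap.fst ℝ _ _
  have hD : ∀ w : V, D w = w.2.1 - A w.1.1 := fun w => rfl
  obtain ⟨n, hnW, hn⟩ := exists_multiplier_of_polyhedral hPQ (LinearMap.ker D) 0
    (by
      obtain ⟨a, ha, b, hb, hab, -⟩ := hatt
      exact ⟨(a, b), ⟨ha, hb⟩, by simp [hD, hab]⟩)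
    (LinearMap.snd ℝ E ℝ ∘ₗ LinearMap.fst ℝ _ _ + LinearMap.snd ℝ F ℝ ∘ₗ LinearMap.snd ℝ _ _) p
    (by
      rintro ⟨⟨x, s⟩, ⟨z, t⟩⟩ ⟨hx, hz⟩ hw
      rw [sub_zero, LinearMap.mem_ker, hD, sub_eq_zero] at hw
      obtain rfl : z = A x := hw
      exact hp x s t hx hz)
  let ι : F →ₗ[ℝ] V := LinearMap.inr ℝ _ _ ∘ₗ LinearMap.inl ℝ F ℝ
  refine ⟨(InnerProductSpace.toDual ℝ F).symm (LinearMap.toContinuousLinearMap (n ∘ₗ ι)),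
    fun a ha b hb => ?_⟩
  have h1 := hn (a, b) ⟨ha, hb⟩
  -- `n` depends on its argument through `z - A x` only
  have h2 : n (a, b) = n (ι (b.1 - A a.1)) := by
    rw [← sub_eq_zero, ← map_sub]
    exact hnW _ (by
      rw [LinearMap.mem_ker, hD]
      change b.1 - (b.1 - A a.1) - (A (a.1 - 0)) = 0
      simp)
  rw [sub_zero, h2] at h1
  rw [InnerProductSpace.toDual_symm_apply]
  simp only [LinearMap.coe_toContinuousLinearMap', LinearMap.comp_apply, LinearMap.add_apply,
    LinearMap.fst_apply, LinearMap.snd_apply] at h1 ⊢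
  linarith

end Duality

/-! ### Subdifferentials, proximal points and growth of the conjugate -/

/-- Upper Lipschitz continuity at `a` tested on bounded parts of the values, with constants that
may depend on the bound. -/
def BoundedUpperLipschitzAt {E F : Type*} [NormedAddCommGroup E] [NormedAddCommGroup F]
    (Ψ : E → Set F) (a : E) : Prop :=
  ∀ R : ℝ, ∃ δ > (0 : ℝ), ∃ κ : ℝ, 0 ≤ κ ∧ ∀ x, ‖x - a‖ ≤ δ → ∀ w ∈ Ψ x, ‖w‖ ≤ R →
    Metric.infDist w (Ψ a) ≤ κ * ‖x - a‖

theorem UpperLipschitzAt.bounded {E F : Type*} [NormedAddCommGroup E] [NormedAddCommGroup F]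
    [InnerProductSpace ℝ F] {Ψ : E → Set F} {a : E} (h : UpperLipschitzAt Ψ a) :
    BoundedUpperLipschitzAt Ψ a := by
  obtain ⟨δ, hδ, κ, hκ, hsub⟩ := h
  refine fun R => ⟨δ, hδ, κ, hκ.le, fun x hx w hw _ => ?_⟩
  obtain ⟨q, hq, z, ⟨b, hb, rfl⟩, rfl⟩ := hsub x (by simpa [dist_eq_norm] using hx) hw
  refine (Metric.infDist_le_dist_of_mem hq).trans ?_
  have hb1 : ‖b‖ ≤ 1 := by simpa using hb
  simp only [dist_eq_norm, add_sub_cancel_left, norm_smul]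
  rw [Real.norm_of_nonneg (by positivity)]
  exact mul_le_of_le_one_right (by positivity) hb1

section Convex

variable {E : Type*} [NormedAddCommGroup E] [InnerProductSpace ℝ E]

theorem exists_real_of_ne {a : EReal} (hbot : a ≠ ⊥) (htop : a ≠ ⊤) : ∃ s : ℝ, a = s :=
  ⟨a.toReal, (EReal.coe_toReal htop hbot).symm⟩

theorem mem_subdiff_iff {φ : E → EReal} {x : E} {s : ℝ} (hs : φ x = s) {y : E} :
    y ∈ subdiff φ x ↔ ∀ p ∈ epigraph φ, s + ⟪y, p.1 - x⟫_ℝ ≤ p.2 := by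
  constructor
  · rintro h ⟨u, t⟩ hut
    have h1 := (h u).trans hut
    rw [hs, ← EReal.coe_add] at h1
    exact_mod_cast h1
  · intro h u
    rw [← EReal.le_of_forall_lt_iff_le]
    intro t ht
    rw [hs, ← EReal.coe_add]
    exact_mod_cast h (u, t) ht.le

theorem IsGammaZero.ne_top_of_mem_subdiff {φ : E → EReal} (hφ : IsGammaZero φ) {x y : E}
    (hy : y ∈ subdiff φ x) : φ x ≠ ⊤ := by
  intro htop
  obtain ⟨u, hu⟩ := hφ.nonempty_effDom
  have := hy u
  rw [htop, EReal.top_add_coe] at this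
  exact absurd (lt_of_le_of_lt this hu) (lt_irrefl _)

theorem isClosed_subdiff {φ : E → EReal} {x : E} {s : ℝ} (hs : φ x = s) :
    IsClosed (subdiff φ x) := by
  have : subdiff φ x = ⋂ p ∈ epigraph φ, {y | s + ⟪y, p.1 - x⟫_ℝ ≤ p.2} := by
    ext y
    simp only [mem_subdiff_iff hs, Set.mem_iInter]
    rfl
  rw [this]
  exact isClosed_biInter fun p _ => isClosed_le (by fun_prop) continuous_const

theorem convex_subdiff {φ : E → EReal} {x : E} {s : ℝ} (hs : φ x = s) :
    Convex ℝ (subdiff φ x) := by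
  intro y hy z hz a b ha hb hab
  rw [mem_subdiff_iff hs] at *
  intro p hp
  have h1 := mul_le_mul_of_nonneg_left (hy p hp) ha
  have h2 := mul_le_mul_of_nonneg_left (hz p hp) hb
  rw [inner_add_left, real_inner_smul_left, real_inner_smul_left]
  have e1 : s = (a + b) * s := by rw [hab, one_mul]
  have e2 : p.2 = (a + b) * p.2 := by rw [hab, one_mul]
  rw [e1, e2]
  linarith

theorem IsGammaZero.isClosed_epigraph {φ : E → EReal} (hφ : IsGammaZero φ) :
    IsClosed (epigraph φ) := by
  have h := hφ.lsc.isClosed_epigraph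
  exact h.preimage (f := fun p : E × ℝ => (p.1, (p.2 : EReal)))
    (by have := continuous_coe_real_ereal; fun_prop)

/-- The proximal point: `x + l • w = u` is solvable with `w ∈ ∂φ(x)`. -/
theorem IsGammaZero.exists_prox [FiniteDimensional ℝ E] {φ : E → EReal} (hφ : IsGammaZero φ)
    {x₀ p₀ : E} (hp₀ : p₀ ∈ subdiff φ x₀) {l : ℝ} (hl : 0 < l) (u : E) :
    ∃ x w : E, w ∈ subdiff φ x ∧ x + l • w = u := by
  obtain ⟨s₀, hs₀⟩ := exists_real_of_ne (hφ.ne_bot x₀) (hφ.ne_top_of_mem_subdiff hp₀)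
  rw [mem_subdiff_iff hs₀] at hp₀
  let Θ : E × ℝ → ℝ := fun p => 2 * l * p.2 + ‖p.1 - u‖ ^ 2
  have hΘ : Continuous Θ := by fun_prop
  set e := ‖x₀ - u‖ with he
  set B := ‖p₀‖ with hB
  have hmem₀ : (x₀, s₀) ∈ epigraph φ := hs₀.le
  -- the subgradient at `x₀` confines the sublevel set of `Θ` to a compact set
  let ρ := 2 * l * B + e
  let K : Set (E × ℝ) := epigraph φ ∩
    (Metric.closedBall u ρ ×ˢ Set.Icc (s₀ - B * (ρ + e)) (Θ (x₀, s₀) / (2 * l)))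
  have hK : IsCompact K :=
    ((isCompact_closedBall u ρ).prod isCompact_Icc).inter_left hφ.isClosed_epigraph
  have hsub : ∀ p ∈ epigraph φ, Θ p ≤ Θ (x₀, s₀) → p ∈ K := by
    rintro ⟨x, t⟩ hp hle
    have h1 := hp₀ _ hp
    have h2 : -(B * ‖x - x₀‖) ≤ ⟪p₀, x - x₀⟫_ℝ :=
      neg_le_of_abs_le (abs_real_inner_le_norm p₀ (x - x₀))
    have h3 : ‖x - x₀‖ ≤ ‖x - u‖ + e := by
      have := norm_sub_le (x - u) (x₀ - u)
      rwa [sub_sub_sub_cancel_right] at this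
    have hB0 : 0 ≤ B := norm_nonneg _
    have he0 : 0 ≤ e := norm_nonneg _
    have h4 : B * ‖x - x₀‖ ≤ B * (‖x - u‖ + e) := mul_le_mul_of_nonneg_left h3 hB0
    simp only [Θ] at hle
    simp only at h1
    have h5 : s₀ - B * (‖x - u‖ + e) ≤ t := by linarith
    have h6 : ‖x - u‖ ≤ ρ := by
      by_contra! hcon
      have h7 : 2 * l * (s₀ - B * (‖x - u‖ + e)) ≤ 2 * l * t :=
        mul_le_mul_of_nonneg_left h5 (by positivity)
      have h8 : ‖x - u‖ ^ 2 - 2 * l * B * ‖x - u‖ ≤ e * (e + 2 * l * B) := by nlinarith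
      have h9 : 0 ≤ 2 * l * B := by positivity
      simp only [ρ] at hcon
      nlinarith
    refine ⟨hp, by simpa [dist_eq_norm] using h6, ?_, ?_⟩
    · have := mul_le_mul_of_nonneg_left h6 hB0
      simp only
      linarith
    · rw [le_div_iff₀ (by positivity)]
      simp only [Θ]
      nlinarith [sq_nonneg ‖x - u‖]
  obtain ⟨⟨x, t⟩, hxK, hmin⟩ := hK.exists_isMinOn ⟨_, hsub _ hmem₀ le_rfl⟩ hΘ.continuousOn
  have hmin' : ∀ p ∈ epigraph φ, Θ (x, t) ≤ Θ p := by
    intro p hp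
    rcases le_or_gt (Θ p) (Θ (x₀, s₀)) with h | h
    · exact hmin (hsub p hp h)
    · exact (hmin (hsub _ hmem₀ le_rfl)).trans h.le
  have hxt : φ x ≤ t := hxK.1
  obtain ⟨s, hs⟩ := exists_real_of_ne (hφ.ne_bot x) (ne_top_of_le_ne_top (EReal.coe_ne_top t) hxt)
  have hst : s = t := by
    rw [hs] at hxt
    have h1 : s ≤ t := by exact_mod_cast hxt
    have h2 := hmin' (x, s) hs.le
    simp only [Θ] at h2
    nlinarith
  subst hst
  refine ⟨x, l⁻¹ • (u - x), (mem_subdiff_iff hs).2 ?_, ?_⟩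
  · rintro ⟨z, τ⟩ hz
    -- first-order condition along the segment from `(x, φ x)` to `(z, τ)`
    have key : ∀ θ : ℝ, 0 < θ → θ ≤ 1 →
        2 * l * (s - τ) + 2 * ⟪u - x, z - x⟫_ℝ ≤ θ * ‖z - x‖ ^ 2 := by
      intro θ hθ hθ1
      have h1 := hmin' _ (hφ.convex_epigraph hxK.1 hz (by linarith : 0 ≤ 1 - θ) hθ.le (by ring))
      have h2 : ((1 - θ) • x + θ • z) - u = (x - u) + θ • (z - x) := by module
      simp only [Θ, Prod.fst_add, Prod.smul_fst, Prod.snd_add, Prod.smul_snd, smul_eq_mul, h2]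
        at h1
      rw [norm_add_sq_real, norm_smul, inner_smul_right, Real.norm_of_nonneg hθ.le] at h1
      have h3 : ⟪x - u, z - x⟫_ℝ = -⟪u - x, z - x⟫_ℝ := by rw [← inner_neg_left, neg_sub]
      rw [h3] at h1
      have h4 : θ * (2 * l * (s - τ) + 2 * ⟪u - x, z - x⟫_ℝ) ≤ θ * (θ * ‖z - x‖ ^ 2) := by
        nlinarith
      exact le_of_mul_le_mul_left h4 hθ
    have hlim : 2 * l * (s - τ) + 2 * ⟪u - x, z - x⟫_ℝ ≤ 0 := by
      by_contra! hpos
      set D := 2 * l * (s - τ) + 2 * ⟪u - x, z - x⟫_ℝ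
      have h1 := key (min 1 (D / (2 * (‖z - x‖ ^ 2 + 1)))) (by positivity) (min_le_left _ _)
      have h2 : min 1 (D / (2 * (‖z - x‖ ^ 2 + 1))) * ‖z - x‖ ^ 2 ≤
          D / (2 * (‖z - x‖ ^ 2 + 1)) * (‖z - x‖ ^ 2 + 1) :=
        mul_le_mul (min_le_right _ _) (by linarith) (by positivity) (by positivity)
      have h3 : D / (2 * (‖z - x‖ ^ 2 + 1)) * (‖z - x‖ ^ 2 + 1) = D / 2 := by
        field_simp
      linarith
    rw [real_inner_smul_left]
    have h5 : l * (s + l⁻¹ * ⟪u - x, z - x⟫_ℝ) ≤ l * τ := by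
      rw [mul_add, mul_inv_cancel_left₀ hl.ne']
      linarith
    exact le_of_mul_le_mul_left h5 hl
  · rw [smul_inv_smul₀ hl.ne']
    abel

/-- The Fenchel–Young inequality holds with equality on the graph of the subdifferential. -/
theorem conjugate_le_of_mem_subdiff {φ : E → EReal} {x v : E} {s : ℝ} (hs : φ x = s)
    (hv : v ∈ subdiff φ x) : conjugate φ v ≤ ((⟪x, v⟫_ℝ - s : ℝ) : EReal) := by
  refine iSup_le fun u => ?_
  have h := hv u
  rw [hs, ← EReal.coe_add] at h
  rcases eq_or_ne (φ u) ⊤ with htop | htop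
  · simp [htop]
  obtain ⟨t, ht⟩ := exists_real_of_ne
    (ne_bot_of_le_ne_bot (EReal.coe_ne_bot _) h) htop
  rw [ht] at h ⊢
  rw [← EReal.coe_sub]
  have h' : s + ⟪v, u - x⟫_ℝ ≤ t := by exact_mod_cast h
  rw [inner_sub_right, real_inner_comm, real_inner_comm x v] at h'
  exact_mod_cast (by linarith)

/-- Quadratic growth of the conjugate: if `∂φ` is upper Lipschitz at `x₀`, then on balls `φ*`
exceeds its affine minorant with slope `x₀` by a multiple of the squared distance to `∂φ(x₀)`.
For a given slope `v`, the proximal point `x` of `x₀ + l • v`, with subgradient `w`, satisfies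
`x - x₀ = l • (v - w)`: testing the supremum at `x` gives the gain `l ‖v - w‖²`, while the
Lipschitz property bounds the distance of `w`, hence of `v`, to `∂φ(x₀)` by a multiple of
`‖v - w‖`. -/
theorem conjugate_growth [FiniteDimensional ℝ E] {φ : E → EReal} (hφ : IsGammaZero φ) {x₀ : E}
    {s₀ : ℝ} (hs₀ : φ x₀ = s₀) (hne : (subdiff φ x₀).Nonempty)
    (hlip : BoundedUpperLipschitzAt (subdiff φ) x₀) (r : ℝ) :
    ∃ c > (0 : ℝ), ∀ v, ‖v‖ ≤ r →
      ((⟪x₀, v⟫_ℝ - s₀ + c * Metric.infDist v (subdiff φ x₀) ^ 2 : ℝ) : EReal) ≤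
        conjugate φ v := by
  obtain ⟨p₀, hp₀⟩ := hne
  set C := subdiff φ x₀ with hC
  rcases lt_or_ge r 0 with hr | hr
  · exact ⟨1, one_pos, fun v hv => absurd (norm_nonneg v) (by linarith)⟩
  set M := r + ‖p₀‖
  have hM : 0 ≤ M := by positivity
  obtain ⟨δ, hδ, κ, hκ, hlip⟩ := hlip (r + M)
  set l := δ / (M + 1) with hl
  have hl0 : 0 < l := by positivity
  refine ⟨l / (1 + κ * l) ^ 2, by positivity, fun v hv => ?_⟩
  obtain ⟨x, w, hw, hxw⟩ := hφ.exists_prox hp₀ hl0 (x₀ + l • v)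
  have hx : x - x₀ = l • (v - w) := by
    rw [smul_sub, sub_eq_sub_iff_add_eq_add, hxw, add_comm]
  obtain ⟨s, hs⟩ := exists_real_of_ne (hφ.ne_bot x) (hφ.ne_top_of_mem_subdiff hw)
  obtain ⟨q, hq, hd, -⟩ := exists_projection ⟨p₀, hp₀⟩ (isClosed_subdiff hs₀)
    (convex_subdiff hs₀) v
  have hw0 := (mem_subdiff_iff hs).1 hw (x₀, s₀) hs₀.le
  have hq0 := (mem_subdiff_iff hs₀).1 hq (x, s) hs.le
  simp only at hw0 hq0
  rw [← neg_sub x x₀, inner_neg_right, hx, inner_smul_right] at hw0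
  rw [hx, inner_smul_right] at hq0
  -- monotonicity of the subdifferential makes `w` closer to `v` than the projection of `v`
  have hvw : ‖v - w‖ ≤ Metric.infDist v C := by
    have h1 : l * ⟪q, v - w⟫_ℝ ≤ l * ⟪w, v - w⟫_ℝ := by linarith
    have h2 := le_of_mul_le_mul_left h1 hl0
    have h3 : ‖v - w‖ ^ 2 ≤ ‖v - q‖ * ‖v - w‖ := by
      calc ‖v - w‖ ^ 2 = ⟪v - w, v - w⟫_ℝ := (real_inner_self_eq_norm_sq _).symm
        _ ≤ ⟪v - q, v - w⟫_ℝ := by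
            rw [inner_sub_left v w, inner_sub_left v q]
            linarith
        _ ≤ _ := real_inner_le_norm _ _
    rw [← hd]
    rcases (norm_nonneg (v - w)).eq_or_lt with h0 | h0
    · rw [← h0]
      positivity
    · rw [sq] at h3
      exact le_of_mul_le_mul_right h3 h0
  have hdM : Metric.infDist v C ≤ M := by
    refine (Metric.infDist_le_dist_of_mem hp₀).trans ((dist_le_norm_add_norm _ _).trans ?_)
    exact add_le_add hv le_rfl
  have hxn : ‖x - x₀‖ = l * ‖v - w‖ := by
    rw [hx, norm_smul, Real.norm_of_nonneg hl0.le]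
  have hxδ : ‖x - x₀‖ ≤ δ := by
    rw [hxn]
    calc l * ‖v - w‖ ≤ l * (M + 1) := by gcongr; linarith
      _ = δ := by rw [hl]; field_simp
  have hwn : ‖w‖ ≤ r + M := by
    have := norm_sub_le v (v - w)
    rw [sub_sub_cancel] at this
    linarith
  have hdist := hlip x hxδ w hw hwn
  have hdv : Metric.infDist v C ≤ (1 + κ * l) * ‖v - w‖ := by
    have := Metric.infDist_le_infDist_add_dist (x := v) (y := w) (s := C)
    rw [dist_eq_norm] at this
    rw [hxn] at hdist
    linarith
  have hgain : l / (1 + κ * l) ^ 2 * Metric.infDist v C ^ 2 ≤ l * ‖v - w‖ ^ 2 := by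
    have h1 : Metric.infDist v C ^ 2 ≤ ((1 + κ * l) * ‖v - w‖) ^ 2 :=
      pow_le_pow_left₀ Metric.infDist_nonneg hdv 2
    calc _ ≤ l / (1 + κ * l) ^ 2 * ((1 + κ * l) * ‖v - w‖) ^ 2 := by gcongr
      _ = _ := by field_simp
  refine le_trans ?_ (le_iSup (fun u : E => ((⟪u, v⟫_ℝ : ℝ) : EReal) - φ u) x)
  simp only [hs]
  rw [← EReal.coe_sub]
  have h1 : ⟪x, v⟫_ℝ = ⟪x₀, v⟫_ℝ + l * (⟪v, v - w⟫_ℝ) := by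
    have : x = x₀ + l • (v - w) := by rw [← hx]; abel
    rw [this, inner_add_left, real_inner_smul_left, real_inner_comm v (v - w)]
  have h2 : ‖v - w‖ ^ 2 = ⟪v, v - w⟫_ℝ - ⟪w, v - w⟫_ℝ := by
    rw [← inner_sub_left, real_inner_self_eq_norm_sq]
  rw [h2] at hgain
  exact_mod_cast (by linarith)

end Convex

/-! ### Polyhedral multifunctions -/

section PolyhedralMaps

variable {E F : Type*} [NormedAddCommGroup E] [InnerProductSpace ℝ E]
  [NormedAddCommGroup F] [InnerProductSpace ℝ F] [FiniteDimensional ℝ E] [FiniteDimensional ℝ F]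

/-- Slices of a polyhedron in a product are polyhedra whose right-hand sides depend affinely on the
base point; this gives a polyhedral slice at `a` and a bound of its violation by points of
neighbouring slices. -/
theorem exists_polyhedral_slice {P : Set (E × F)} (hP : IsPolyhedralSet P) (a : E) :
    ∃ (s : Finset (F × ℝ)) (M : ℝ), 0 ≤ M ∧ polyhedron s = {w | (a, w) ∈ P} ∧
      ∀ x w, (x, w) ∈ P → ∀ c ∈ s, ⟪c.1, w⟫_ℝ - c.2 ≤ M * ‖x - a‖ := by
  classical
  obtain ⟨N, α, b, rfl⟩ := hP
  let β : Fin N → F := fun k => (InnerProductSpace.toDual ℝ F).symm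
    (LinearMap.toContinuousLinearMap (α k ∘ₗ LinearMap.inr ℝ E F))
  let γ : Fin N → (E →L[ℝ] ℝ) := fun k =>
    LinearMap.toContinuousLinearMap (α k ∘ₗ LinearMap.inl ℝ E F)
  have hα : ∀ k x w, α k (x, w) = γ k x + ⟪β k, w⟫_ℝ := fun k x w => by
    rw [InnerProductSpace.toDual_symm_apply]
    simp only [γ, LinearMap.coe_toContinuousLinearMap', LinearMap.comp_apply, LinearMap.inl_apply,
      LinearMap.inr_apply]
    rw [← map_add, Prod.mk_add_mk, add_zero, zero_add]
  refine ⟨Finset.univ.image fun k => (β k, b k - γ k a), ∑ k, ‖γ k‖,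
    Finset.sum_nonneg fun k _ => norm_nonneg _, ?_, ?_⟩
  · ext w
    simp [polyhedron, hα, le_sub_iff_add_le, add_comm]
  · intro x w hxw c hc
    obtain ⟨k, -, rfl⟩ := Finset.mem_image.1 hc
    have h1 : γ k x + ⟪β k, w⟫_ℝ ≤ b k := hα k x w ▸ hxw k
    have h2 : -γ k (x - a) ≤ ‖γ k‖ * ‖x - a‖ :=
      (neg_le_abs _).trans ((γ k).le_opNorm (x - a))
    have h3 : ‖γ k‖ * ‖x - a‖ ≤ (∑ k, ‖γ k‖) * ‖x - a‖ :=
      mul_le_mul_of_nonneg_right (Finset.single_le_sum (f := fun k => ‖γ k‖)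
        (fun k _ => norm_nonneg _) (Finset.mem_univ k)) (norm_nonneg _)
    rw [map_sub] at h2
    simp only
    linarith

/-- Robinson's theorem for bounded parts: a polyhedral multifunction is upper Lipschitz at every
point with nonempty value. -/
theorem IsPolyhedralMap.boundedUpperLipschitzAt {Ψ : E → Set F} (h : IsPolyhedralMap Ψ) {a : E}
    (hne : (Ψ a).Nonempty) : BoundedUpperLipschitzAt Ψ a := by
  obtain ⟨n, P, hP, hgraph⟩ := h
  have hmem : ∀ x w, w ∈ Ψ x ↔ ∃ k, (x, w) ∈ P k := fun x w => by
    rw [← Set.mem_iUnion, ← hgraph]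
    rfl
  intro R
  choose s M hM hs hres using fun k => exists_polyhedral_slice (hP k) a
  have hsub : ∀ k, polyhedron (s k) ⊆ Ψ a := fun k w hw => by
    rw [hs k] at hw
    exact (hmem a w).2 ⟨k, hw⟩
  choose H hH hbd using fun k => exists_local_hoffman_bound (s k) (hsub k) hne R
  have hHM : ∀ k, 0 ≤ H k * M k := fun k => mul_nonneg (hH k) (hM k)
  refine ⟨1, one_pos, ∑ k, H k * M k, Finset.sum_nonneg fun k _ => hHM k,
    fun x _ w hw hwR => ?_⟩
  obtain ⟨k, hk⟩ := (hmem x w).1 hw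
  refine (hbd k w hwR _ (mul_nonneg (hM k) (norm_nonneg (x - a))) (hres k x w hk)).trans ?_
  rw [← mul_assoc]
  exact mul_le_mul_of_nonneg_right
    (Finset.single_le_sum (fun k _ => hHM k) (Finset.mem_univ k)) (norm_nonneg _)

/-- Preimages of values of a polyhedral multifunction under linear maps are finite unions of
polyhedra. -/
theorem IsPolyhedralMap.hasPolyhedralPieces_preimage {Ψ : E → Set F}
    (h : IsPolyhedralMap Ψ) {a : E}
    {V : Type*} [NormedAddCommGroup V] [InnerProductSpace ℝ V] [FiniteDimensional ℝ V]
    (T : V →ₗ[ℝ] F) (hne : (Ψ a).Nonempty) (hcl : IsClosed (Ψ a)) (ρ : V → ℝ)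
    (hρ : ∀ y, Metric.infDist (T y) (Ψ a) ≤ ρ y) : HasPolyhedralPieces (T ⁻¹' Ψ a) ρ := by
  classical
  obtain ⟨n, P, hP, hgraph⟩ := h
  have hmem : ∀ x w, w ∈ Ψ x ↔ ∃ k, (x, w) ∈ P k := fun x w => by
    rw [← Set.mem_iUnion, ← hgraph]
    rfl
  choose s M hM hs hres using fun k => exists_polyhedral_slice (hP k) a
  refine ⟨n, fun k => (s k).image fun c => (T.adjoint c.1, c.2), ∑ k, ∑ c ∈ s k, ‖c.1‖,
    Finset.sum_nonneg fun k _ => Finset.sum_nonneg fun c _ => norm_nonneg _, ?_, ?_⟩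
  · intro k y hy
    refine (hmem a (T y)).2 ⟨k, ?_⟩
    have : T y ∈ polyhedron (s k) := fun c hc => by
      have := hy _ (Finset.mem_image_of_mem _ hc)
      rwa [LinearMap.adjoint_inner_left] at this
    rw [hs k] at this
    exact this
  · intro y
    obtain ⟨q, hq, hd⟩ := hcl.exists_infDist_eq_dist hne (T y)
    obtain ⟨k, hk⟩ := (hmem a q).1 hq
    have hqk : q ∈ polyhedron (s k) := by
      rw [hs k]
      exact hk
    refine ⟨k, fun c hc => ?_⟩
    obtain ⟨c, hcs, rfl⟩ := Finset.mem_image.1 hc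
    simp only [LinearMap.adjoint_inner_left]
    have h1 : ‖c.1‖ ≤ ∑ k, ∑ c ∈ s k, ‖c.1‖ :=
      (Finset.single_le_sum (f := fun c : F × ℝ => ‖c.1‖) (fun c _ => norm_nonneg _) hcs).trans
        (Finset.single_le_sum (f := fun k => ∑ c ∈ s k, ‖c.1‖)
          (fun k _ => Finset.sum_nonneg fun c _ => norm_nonneg _) (Finset.mem_univ k))
    calc ⟪c.1, T y⟫_ℝ - c.2 ≤ ⟪c.1, T y - q⟫_ℝ := by
          rw [inner_sub_right]
          linarith [hqk c hcs]
      _ ≤ ‖c.1‖ * ‖T y - q‖ := real_inner_le_norm _ _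
      _ ≤ _ := by
          rw [← dist_eq_norm, ← hd]
          exact mul_le_mul h1 (hρ y) Metric.infDist_nonneg ((norm_nonneg _).trans h1)

end PolyhedralMaps

/-! ### Regularity under the relative interior condition -/

section Regularity

variable {E F : Type*} [NormedAddCommGroup E] [InnerProductSpace ℝ E]
  [NormedAddCommGroup F] [InnerProductSpace ℝ F] [FiniteDimensional ℝ E]

/-- If `0` is a relative interior point of `C₁ + T C₂`, small vectors of the spanned subspace are
sums `q + T p` with uniformly bounded `p`: a simplex around `0` has finitely many vertices. -/
theorem exists_bounded_decomposition {C₁ : Set E} {C₂ : Set F} (h₁ : Convex ℝ C₁)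
    (h₂ : Convex ℝ C₂) (T : F →ₗ[ℝ] E) (h0 : (0 : E) ∈ intrinsicInterior ℝ (C₁ + T '' C₂)) :
    ∃ ε > (0 : ℝ), ∃ R : ℝ, 0 ≤ R ∧ ∀ u ∈ vectorSpan ℝ (C₁ + T '' C₂), ‖u‖ ≤ ε →
      ∃ q ∈ C₁, ∃ p ∈ C₂, ‖p‖ ≤ R ∧ q + T p = u := by
  obtain ⟨ε₀, hε₀, hball⟩ := exists_ball_of_mem_intrinsicInterior h0
  set L := vectorSpan ℝ (C₁ + T '' C₂)
  obtain ⟨b, hb0, hbs⟩ := exists_mem_interior_convexHull_affineBasis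
    (Metric.ball_mem_nhds (0 : L) hε₀)
  have hvert : ∀ k, ∃ q ∈ C₁, ∃ p ∈ C₂, q + T p = (b k : E) := fun k => by
    have h1 : b k ∈ Metric.ball (0 : L) ε₀ := hbs (subset_convexHull ℝ _ ⟨k, rfl⟩)
    have h2 := hball (b k) (b k).2 (by simpa using h1)
    rw [zero_add] at h2
    obtain ⟨q, hq, _, ⟨p, hp, rfl⟩, h⟩ := h2
    exact ⟨q, hq, p, hp, h⟩
  choose q hq p hp hqp using hvert
  set R := ∑ k, ‖p k‖ with hR
  let G : Set L := {u | ∃ q ∈ C₁, ∃ p ∈ C₂, ‖p‖ ≤ R ∧ q + T p = (u : E)}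
  have hG : Convex ℝ G := by
    rintro u ⟨q, hq, p, hp, hpR, hu⟩ u' ⟨q', hq', p', hp', hpR', hu'⟩ c d hc hd hcd
    refine ⟨c • q + d • q', h₁ hq hq' hc hd hcd, c • p + d • p', h₂ hp hp' hc hd hcd, ?_, ?_⟩
    · have := convex_closedBall (0 : F) R (x := p) (by simpa using hpR) (y := p')
        (by simpa using hpR') hc hd hcd
      simpa using this
    · simp only [map_add, map_smul, Submodule.coe_add, Submodule.coe_smul, ← hu, ← hu', smul_add]
      abel
  have hsub : convexHull ℝ (Set.range b) ⊆ G := convexHull_min (by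
    rintro _ ⟨k, rfl⟩
    exact ⟨q k, hq k, p k, hp k,
      Finset.single_le_sum (f := fun k => ‖p k‖) (fun k _ => norm_nonneg _) (Finset.mem_univ k),
      hqp k⟩) hG
  have hnhds : G ∈ nhds (0 : L) := Filter.mem_of_superset (mem_interior_iff_mem_nhds.1 hb0) hsub
  obtain ⟨ε, hε, hεG⟩ := Metric.nhds_basis_closedBall.mem_iff.1 hnhds
  refine ⟨ε, hε, R, Finset.sum_nonneg fun k _ => norm_nonneg _, fun u hu huε => ?_⟩
  exact hεG (show (⟨u, hu⟩ : L) ∈ Metric.closedBall 0 ε by simpa using huε)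

/-- Linear regularity of `{p ∈ C₂ | -T p ∈ C₁}` on bounded sets when `0 ∈ ri (C₁ + T C₂)`: the
defect `q + T p` is cancelled by mixing in a decomposition of a small negative multiple of it. -/
theorem exists_infDist_le_of_mem_intrinsicInterior {C₁ : Set E} {C₂ : Set F} (h₁ : Convex ℝ C₁)
    (h₂ : Convex ℝ C₂) (T : F →ₗ[ℝ] E) (h0 : (0 : E) ∈ intrinsicInterior ℝ (C₁ + T '' C₂))
    (R : ℝ) :
    ∃ K : ℝ, 0 ≤ K ∧ ∀ p ∈ C₂, ‖p‖ ≤ R → ∀ q ∈ C₁,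
      Metric.infDist p {p | p ∈ C₂ ∧ -T p ∈ C₁} ≤ K * ‖q + T p‖ := by
  obtain ⟨ε, hε, R₀, hR₀, hdec⟩ := exists_bounded_decomposition h₁ h₂ T h0
  refine ⟨(|R| + R₀) / ε, by positivity, fun p hp hpR q hq => ?_⟩
  set e := q + T p with he
  rcases (norm_nonneg e).eq_or_lt with h | hpos
  · have he0 : e = 0 := norm_eq_zero.1 h.symm
    have : p ∈ {p | p ∈ C₂ ∧ -T p ∈ C₁} := ⟨hp, by
      rw [← eq_neg_of_add_eq_zero_left (he ▸ he0)]
      exact hq⟩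
    rw [Metric.infDist_zero_of_mem this]
    positivity
  have heL : e ∈ vectorSpan ℝ (C₁ + T '' C₂) := by
    have := vsub_mem_vectorSpan ℝ (Set.add_mem_add hq (Set.mem_image_of_mem T hp))
      (intrinsicInterior_subset h0)
    simpa using this
  obtain ⟨q', hq', p', hp', hpR', hqp'⟩ := hdec (-(ε / ‖e‖) • e) (Submodule.smul_mem _ _ heL) (by
    rw [norm_smul, norm_neg, Real.norm_of_nonneg (by positivity), div_mul_cancel₀ _ hpos.ne'])
  set t := ‖e‖ / (‖e‖ + ε) with ht
  have ht0 : 0 ≤ t := by positivity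
  have ht1 : 0 ≤ 1 - t := by
    rw [sub_nonneg, ht, div_le_one (by positivity)]
    linarith
  have hmem : (1 - t) • p + t • p' ∈ {p | p ∈ C₂ ∧ -T p ∈ C₁} := by
    refine ⟨h₂ hp hp' ht1 ht0 (by ring), ?_⟩
    have hz : ((1 - t) • q + t • q') + T ((1 - t) • p + t • p') = 0 := by
      have h3 : ((1 - t) • q + t • q') + T ((1 - t) • p + t • p') =
          (1 - t) • e + t • (q' + T p') := by
        rw [he]
        simp only [map_add, map_smul, smul_add]
        abel
      rw [h3, hqp', smul_smul, ← add_smul]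
      have : 1 - t + t * -(ε / ‖e‖) = 0 := by
        rw [ht]
        field_simp
        ring
      rw [this, zero_smul]
    rw [← eq_neg_of_add_eq_zero_left hz]
    exact h₁ hq hq' ht1 ht0 (by ring)
  refine (Metric.infDist_le_dist_of_mem hmem).trans ?_
  have h1 : p - ((1 - t) • p + t • p') = t • (p - p') := by module
  rw [dist_eq_norm, h1, norm_smul, Real.norm_of_nonneg ht0]
  have h2 : ‖p - p'‖ ≤ |R| + R₀ :=
    (norm_sub_le _ _).trans (add_le_add (hpR.trans (le_abs_self R)) hpR')
  have h3 : t ≤ ‖e‖ / ε := by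
    rw [ht]
    gcongr
    linarith
  calc t * ‖p - p'‖ ≤ ‖e‖ / ε * (|R| + R₀) := by gcongr
    _ = _ := by ring

end Regularity

/-! ### Optimality conditions for the composite problem -/

section Optimality

variable {E F : Type*} [NormedAddCommGroup E] [InnerProductSpace ℝ E]
  [NormedAddCommGroup F] [InnerProductSpace ℝ F]

theorem effDom_eq_image_epigraph {E : Type*} {φ : E → EReal} (hφ : ∀ x, φ x ≠ ⊥) :
    effDom φ = Prod.fst '' epigraph φ := by
  ext x
  constructor
  · intro hx
    obtain ⟨s, hs⟩ := exists_real_of_ne (hφ x) (ne_of_lt hx)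
    exact ⟨(x, s), hs.le, rfl⟩
  · rintro ⟨⟨x, s⟩, hs, rfl⟩
    exact lt_of_le_of_lt hs (EReal.coe_lt_top s)

theorem ConstraintQualification.exists_feasible {f : E → EReal} {g : F → EReal} {A : E →ₗ[ℝ] F}
    (h : ConstraintQualification f g A) : ∃ x ∈ effDom f, A x ∈ effDom g := by
  rcases h with h | ⟨-, z, hz, x, hx, rfl⟩ | ⟨-, -, z, hz, x, hx, rfl⟩
  · obtain ⟨z, hz, _, ⟨x, hx, rfl⟩, hzx⟩ := intrinsicInterior_subset h
    exact ⟨x, hx, by rwa [← sub_eq_zero.1 hzx]⟩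
  · exact ⟨x, intrinsicInterior_subset hx, hz⟩
  · exact ⟨x, hx, hz⟩

/-- Existence of a dual certificate: under the constraint qualification, `0 ∈ ∂f + A* ∂g A` at a
minimizer of `f + g ∘ A`. -/
theorem exists_subgradient_of_minimizer [FiniteDimensional ℝ E] [FiniteDimensional ℝ F]
    {f : E → EReal} {g : F → EReal} {A : E →ₗ[ℝ] F}
    (hf : ∀ x, f x ≠ ⊥) (hg : ∀ z, g z ≠ ⊥) (hfc : Convex ℝ (epigraph f))
    (hgc : Convex ℝ (epigraph g)) (hcq : ConstraintQualification f g A) {x₀ : E} {s₀ t₀ : ℝ}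
    (hs₀ : f x₀ = s₀) (ht₀ : g (A x₀) = t₀) (hmin : ∀ x, f x₀ + g (A x₀) ≤ f x + g (A x)) :
    ∃ y ∈ subdiff g (A x₀), -A.adjoint y ∈ subdiff f x₀ := by
  have hp : ∀ x s t, (x, s) ∈ epigraph f → (A x, t) ∈ epigraph g → s₀ + t₀ ≤ s + t := by
    intro x s t hx ht
    have := (hmin x).trans (add_le_add hx ht)
    rw [hs₀, ht₀, ← EReal.coe_add, ← EReal.coe_add] at this
    exact_mod_cast this
  have hatt : ∃ a ∈ epigraph f, ∃ b ∈ epigraph g, b.1 = A a.1 ∧ a.2 + b.2 ≤ s₀ + t₀ :=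
    ⟨(x₀, s₀), hs₀.le, (A x₀, t₀), ht₀.le, rfl, le_rfl⟩
  obtain ⟨y, hy⟩ : ∃ y : F, ∀ a ∈ epigraph f, ∀ b ∈ epigraph g,
      s₀ + t₀ + ⟪y, b.1 - A a.1⟫_ℝ ≤ a.2 + b.2 := by
    rcases hcq with h | ⟨hgp, z, hz, x, hx, rfl⟩ | ⟨hfp, hgp, -⟩
    · rw [effDom_eq_image_epigraph hf, effDom_eq_image_epigraph hg] at h
      refine exists_multiplier_of_absorbing A hfc hgc _ hp hatt
        (vectorSpan ℝ (Prod.fst '' epigraph g - A '' (Prod.fst '' epigraph f)))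
        (fun a ha b hb => ?_) (fun u hu => ?_)
      · have := vsub_mem_vectorSpan ℝ (Set.sub_mem_sub (Set.mem_image_of_mem Prod.fst hb)
          (Set.mem_image_of_mem A (Set.mem_image_of_mem Prod.fst ha))) (intrinsicInterior_subset h)
        simpa using this
      · obtain ⟨c, hc, _, ⟨b, hb, rfl⟩, _, ⟨_, ⟨a, ha, rfl⟩, rfl⟩, hab⟩ :=
          exists_smul_of_mem_intrinsicInterior h hu
        rw [zero_add] at hab
        exact ⟨c, hc, a, ha, b, hb, hab⟩
    · obtain ⟨t, ht⟩ := exists_real_of_ne (hg _) (ne_of_lt hz)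
      rw [effDom_eq_image_epigraph hf] at hx
      exact exists_multiplier_of_polyhedral_right A hfc hgc hgp _ hp hatt ⟨x, hx, t, ht.le⟩
    · exact exists_multiplier_of_polyhedral_both A hfp hgp _ hp hatt
  refine ⟨y, (mem_subdiff_iff ht₀).2 fun b hb => ?_, (mem_subdiff_iff hs₀).2 fun a ha => ?_⟩
  · have := hy (x₀, s₀) hs₀.le b hb
    simp only at this
    linarith
  · have := hy a ha (A x₀, t₀) ht₀.le
    rw [inner_neg_left, LinearMap.adjoint_inner_left, ← inner_neg_right, ← map_neg, neg_sub,
      map_sub]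
    simp only at this
    linarith

end Optimality

/-! ### Separable functions -/

section Separable

variable {I : Type*} [Fintype I] {X : I → Type*}

theorem ereal_sum_ne_bot {ι : Type*} (s : Finset ι) {a : ι → EReal} (h : ∀ i, a i ≠ ⊥) :
    ∑ i ∈ s, a i ≠ ⊥ := by
  classical
  induction s using Finset.induction_on with
  | empty => simp
  | insert i s hi ih =>
    rw [Finset.sum_insert hi]
    exact EReal.add_ne_bot_iff.2 ⟨h i, ih⟩

theorem ereal_coe_sum {ι : Type*} (s : Finset ι) (a : ι → ℝ) :
    ((∑ i ∈ s, a i : ℝ) : EReal) = ∑ i ∈ s, (a i : EReal) := by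
  classical
  induction s using Finset.induction_on with
  | empty => simp
  | insert i s hi ih => rw [Finset.sum_insert hi, Finset.sum_insert hi, EReal.coe_add, ih]

theorem exists_real_of_sum_lt_top {a : I → EReal} (h : ∀ i, a i ≠ ⊥) (hlt : ∑ i, a i < ⊤) :
    ∃ s : I → ℝ, ∀ i, a i = s i := by
  classical
  refine Classical.skolem.1 fun i => exists_real_of_ne (h i) fun htop => ?_
  rw [← Finset.add_sum_erase _ _ (Finset.mem_univ i), htop,
    EReal.top_add_of_ne_bot (ereal_sum_ne_bot _ h)] at hlt
  exact lt_irrefl _ hlt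

theorem sepSum_eq_coe {φ : ∀ i, X i → EReal} {x : PiLp 2 X} {s : I → ℝ}
    (hs : ∀ i, φ i (x i) = s i) : sepSum φ x = ((∑ i, s i : ℝ) : EReal) := by
  rw [ereal_coe_sum]
  exact Finset.sum_congr rfl fun i _ => hs i

theorem mem_epigraph_sepSum {φ : ∀ i, X i → EReal} (hφ : ∀ i x, φ i x ≠ ⊥)
    {p : PiLp 2 X × ℝ} :
    p ∈ epigraph (sepSum φ) ↔ ∃ s : I → ℝ, (∀ i, φ i (p.1 i) ≤ s i) ∧ ∑ i, s i ≤ p.2 := by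
  constructor
  · intro hp
    obtain ⟨s, hs⟩ := exists_real_of_sum_lt_top (fun i => hφ i (p.1 i))
      (lt_of_le_of_lt hp (EReal.coe_lt_top _))
    refine ⟨s, fun i => (hs i).le, ?_⟩
    have : sepSum φ p.1 ≤ p.2 := hp
    rw [sepSum_eq_coe hs] at this
    exact_mod_cast this
  · rintro ⟨s, hs, hsum⟩
    calc sepSum φ p.1 ≤ ∑ i, (s i : EReal) := Finset.sum_le_sum fun i _ => hs i
      _ = ((∑ i, s i : ℝ) : EReal) := (ereal_coe_sum _ _).symm
      _ ≤ p.2 := by exact_mod_cast hsum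

variable [∀ i, NormedAddCommGroup (X i)]

theorem norm_le_sum_norm (x : PiLp 2 X) : ‖x‖ ≤ ∑ i, ‖x i‖ := by
  refine le_of_sq_le_sq ?_ (Finset.sum_nonneg fun i _ => norm_nonneg _)
  rw [PiLp.norm_sq_eq_of_L2]
  exact Finset.sum_sq_le_sq_sum_of_nonneg fun i _ => norm_nonneg _

variable [∀ i, InnerProductSpace ℝ (X i)]

theorem convex_epigraph_sepSum {φ : ∀ i, X i → EReal} (hφ : ∀ i x, φ i x ≠ ⊥)
    (hc : ∀ i, Convex ℝ (epigraph (φ i))) : Convex ℝ (epigraph (sepSum φ)) := by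
  intro p hp q hq a b ha hb hab
  obtain ⟨s, hs, hsum⟩ := (mem_epigraph_sepSum hφ).1 hp
  obtain ⟨t, ht, htum⟩ := (mem_epigraph_sepSum hφ).1 hq
  refine (mem_epigraph_sepSum hφ).2 ⟨fun i => a * s i + b * t i, fun i => ?_, ?_⟩
  · exact hc i (x := (p.1 i, s i)) (hs i) (y := (q.1 i, t i)) (ht i) ha hb hab
  · rw [Finset.sum_add_distrib, ← Finset.mul_sum, ← Finset.mul_sum]
    exact add_le_add (mul_le_mul_of_nonneg_left hsum ha) (mul_le_mul_of_nonneg_left htum hb)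

/-- The subdifferential of a separable function is the product of the subdifferentials. -/
theorem mem_subdiff_sepSum {φ : ∀ i, X i → EReal} (hφ : ∀ i x, φ i x ≠ ⊥) {x : PiLp 2 X}
    {s : I → ℝ} (hs : ∀ i, φ i (x i) = s i) {v : PiLp 2 X} :
    v ∈ subdiff (sepSum φ) x ↔ ∀ i, v i ∈ subdiff (φ i) (x i) := by
  classical
  rw [mem_subdiff_iff (sepSum_eq_coe hs)]
  constructor
  · intro h i
    rw [mem_subdiff_iff (hs i)]
    rintro ⟨u, t⟩ hut
    -- vary the `i`-th block only
    have h1 := h (WithLp.toLp 2 (Function.update x.ofLp i u),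
        ∑ k, Function.update s i t k) ((mem_epigraph_sepSum hφ).2
      ⟨Function.update s i t, fun k => by
        rcases eq_or_ne k i with rfl | hk
        · simpa [epigraph] using hut
        · simp [hk, hs k], le_rfl⟩)
    have h2 : ⟪v, WithLp.toLp 2 (Function.update x.ofLp i u) - x⟫_ℝ = ⟪v i, u - x i⟫_ℝ := by
      rw [PiLp.inner_apply, Finset.sum_eq_single i (fun k _ hk => by simp [hk]) (by simp)]
      simp
    have h3 : ∑ k, Function.update s i t k = t + (∑ k, s k - s i) := by
      rw [Finset.sum_update_of_mem (Finset.mem_univ i), Finset.sdiff_singleton_eq_erase,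
        Finset.sum_erase_eq_sub (Finset.mem_univ i)]
    simp only [h2, h3] at h1 ⊢
    linarith
  · intro h p hp
    obtain ⟨t, ht, hsum⟩ := (mem_epigraph_sepSum hφ).1 hp
    refine le_trans ?_ hsum
    rw [PiLp.inner_apply, ← Finset.sum_add_distrib]
    exact Finset.sum_le_sum fun i _ => (mem_subdiff_iff (hs i)).1 (h i) (p.1 i, t i) (ht i)

end Separable

/-! ### Quadratic growth of the dual objective -/

section Dual

variable {I J : Type*} [Fintype I] [Fintype J]
  {X : I → Type*} [∀ i, NormedAddCommGroup (X i)] [∀ i, InnerProductSpace ℝ (X i)]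
  [∀ i, FiniteDimensional ℝ (X i)]
  {Y : J → Type*} [∀ j, NormedAddCommGroup (Y j)] [∀ j, InnerProductSpace ℝ (Y j)]
  [∀ j, FiniteDimensional ℝ (Y j)]

theorem blockMap_adjoint_apply (A : ∀ j i, X i →ₗ[ℝ] Y j) (y : PiLp 2 Y) (i : I) :
    (blockMap A).adjoint y i = ∑ j, (A j i).adjoint (y j) := by
  classical
  refine ext_inner_right ℝ fun u => ?_
  have h := LinearMap.adjoint_inner_left (blockMap A) (WithLp.toLp 2 (Pi.single i u)) y
  rw [PiLp.inner_apply, PiLp.inner_apply,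
    Finset.sum_eq_single i (fun k _ hk => by simp [hk]) (by simp)] at h
  have h1 : ∀ j, blockMap A (WithLp.toLp 2 (Pi.single i u)) j = A j i u := fun j => by
    change ∑ k, A j k ((Pi.single i u : ∀ k, X k) k) = A j i u
    rw [Finset.sum_eq_single i (fun k _ hk => by simp [hk]) (by simp)]
    simp
  simp only [h1, Pi.single_eq_same] at h
  rw [h, sum_inner]
  exact Finset.sum_congr rfl fun j _ => (LinearMap.adjoint_inner_left _ _ _).symm

/-- The argument of the `i`-th conjugate in the dual objective, as a linear map of `y`. -/
noncomputable def dualArg (A : ∀ j i, X i →ₗ[ℝ] Y j) (i : I) : PiLp 2 Y →ₗ[ℝ] X i :=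
  -((PiLp.projₗ 2 X i) ∘ₗ (blockMap A).adjoint)

theorem dualArg_apply (A : ∀ j i, X i →ₗ[ℝ] Y j) (i : I) (y : PiLp 2 Y) :
    dualArg A i y = -∑ j, (A j i).adjoint (y j) := by
  rw [← blockMap_adjoint_apply]
  rfl

theorem dualArg_eq (A : ∀ j i, X i →ₗ[ℝ] Y j) (i : I) (y : PiLp 2 Y) :
    dualArg A i y = (-(blockMap A).adjoint y) i := rfl

/-- The affine parts of the conjugate bounds cancel in the dual objective. -/
theorem sum_inner_dualArg (A : ∀ j i, X i →ₗ[ℝ] Y j) (x : PiLp 2 X) (y : PiLp 2 Y) :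
    ∑ i, ⟪x i, dualArg A i y⟫_ℝ + ∑ j, ⟪blockMap A x j, y j⟫_ℝ = 0 := by
  simp only [dualArg_eq]
  rw [← PiLp.inner_apply, ← PiLp.inner_apply, inner_neg_right, LinearMap.adjoint_inner_right,
    neg_add_cancel]

theorem exists_pos_le {ι : Type*} [Fintype ι] {c : ι → ℝ} (hc : ∀ i, 0 < c i) :
    ∃ m > (0 : ℝ), ∀ i, m ≤ c i := by
  have h0 : ∀ i, 0 ≤ 1 / c i := fun i => (one_div_pos.2 (hc i)).le
  have hS : 0 ≤ ∑ i, 1 / c i := Finset.sum_nonneg fun i _ => h0 i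
  refine ⟨1 / (1 + ∑ i, 1 / c i), by positivity, fun i => ?_⟩
  rw [one_div_le (by positivity) (hc i)]
  have := Finset.single_le_sum (fun i _ => h0 i) (Finset.mem_univ i)
  linarith

/-- The points `y` that are, blockwise, certificates of optimality of `x`. -/
def certificates (f : ∀ i, X i → EReal) (g : ∀ j, Y j → EReal) (A : ∀ j i, X i →ₗ[ℝ] Y j)
    (x : PiLp 2 X) : Set (PiLp 2 Y) :=
  {y | (∀ i, dualArg A i y ∈ subdiff (f i) (x i)) ∧
    ∀ j, y j ∈ subdiff (g j) (blockMap A x j)}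

/-- The sum of the blockwise distances of `y` from the conditions defining `certificates`. -/
noncomputable def certificateDefect (f : ∀ i, X i → EReal) (g : ∀ j, Y j → EReal)
    (A : ∀ j i, X i →ₗ[ℝ] Y j) (x : PiLp 2 X) (y : PiLp 2 Y) : ℝ :=
  ∑ i, Metric.infDist (dualArg A i y) (subdiff (f i) (x i)) +
    ∑ j, Metric.infDist (y j) (subdiff (g j) (blockMap A x j))

variable {f : ∀ i, X i → EReal} {g : ∀ j, Y j → EReal} {A : ∀ j i, X i →ₗ[ℝ] Y j}
  {x : PiLp 2 X} {s : I → ℝ} {t : J → ℝ}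

theorem certificateDefect_nonneg (y : PiLp 2 Y) : 0 ≤ certificateDefect f g A x y :=
  add_nonneg (Finset.sum_nonneg fun _ _ => Metric.infDist_nonneg)
    (Finset.sum_nonneg fun _ _ => Metric.infDist_nonneg)

/-- Error bound for the set of certificates when the subdifferentials are polyhedral. -/
theorem exists_infDist_certificates_le_of_polyhedral (hs : ∀ i, f i (x i) = s i)
    (ht : ∀ j, g j (blockMap A x j) = t j)
    (hf : ∀ i, IsPolyhedralMap (subdiff (f i))) (hg : ∀ j, IsPolyhedralMap (subdiff (g j)))
    (hne : (certificates f g A x).Nonempty) (r : ℝ) :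
    ∃ K : ℝ, 0 ≤ K ∧ ∀ y, ‖y‖ ≤ r →
      Metric.infDist y (certificates f g A x) ≤ K * certificateDefect f g A x y := by
  let S : I ⊕ J → Set (PiLp 2 Y) := Sum.elim (fun i => dualArg A i ⁻¹' subdiff (f i) (x i))
    (fun j => PiLp.projₗ (𝕜 := ℝ) 2 Y j ⁻¹' subdiff (g j) (blockMap A x j))
  have hS : certificates f g A x = ⋂ k, S k := by
    ext y
    simp only [Set.mem_iInter, Sum.forall]
    rfl
  obtain ⟨y₀, hy₀⟩ := hne
  rw [hS]
  refine exists_infDist_iInter_le S _ certificateDefect_nonneg ?_ (hS ▸ ⟨y₀, hy₀⟩) r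
  rintro (i | j)
  · refine (hf i).hasPolyhedralPieces_preimage _ ⟨_, hy₀.1 i⟩ (isClosed_subdiff (hs i)) _
      fun y => ?_
    exact (Finset.single_le_sum
      (f := fun i => Metric.infDist (dualArg A i y) (subdiff (f i) (x i)))
      (fun _ _ => Metric.infDist_nonneg) (Finset.mem_univ i)).trans
      (le_add_of_nonneg_right (Finset.sum_nonneg fun _ _ => Metric.infDist_nonneg))
  · refine (hg j).hasPolyhedralPieces_preimage _ ⟨_, hy₀.2 j⟩ (isClosed_subdiff (ht j)) _
      fun y => ?_
    exact (Finset.single_le_sum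
      (f := fun j => Metric.infDist (y j) (subdiff (g j) (blockMap A x j)))
      (fun _ _ => Metric.infDist_nonneg) (Finset.mem_univ j)).trans
      (le_add_of_nonneg_left (Finset.sum_nonneg fun _ _ => Metric.infDist_nonneg))

/-- Error bound for the set of certificates under the relative interior condition. -/
theorem exists_infDist_certificates_le_of_intrinsicInterior (hf : ∀ i u, f i u ≠ ⊥)
    (hg : ∀ j z, g j z ≠ ⊥) (hs : ∀ i, f i (x i) = s i) (ht : ∀ j, g j (blockMap A x j) = t j)
    (h0 : (0 : PiLp 2 X) ∈ intrinsicInterior ℝ (subdiff (sepSum f) x +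
      (blockMap A).adjoint '' subdiff (sepSum g) (blockMap A x)))
    (hne : (certificates f g A x).Nonempty) (r : ℝ) :
    ∃ K : ℝ, 0 ≤ K ∧ ∀ y, ‖y‖ ≤ r →
      Metric.infDist y (certificates f g A x) ≤ K * certificateDefect f g A x y := by
  obtain ⟨y₀, hy₀⟩ := hne
  set T := (blockMap A).adjoint with hT
  have hcert : certificates f g A x = {p | p ∈ subdiff (sepSum g) (blockMap A x) ∧
      -T p ∈ subdiff (sepSum f) x} := by
    ext y
    rw [Set.mem_ofPred_eq, mem_subdiff_sepSum hf hs, mem_subdiff_sepSum hg ht, and_comm]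
    rfl
  obtain ⟨K, hK, hbd⟩ := exists_infDist_le_of_mem_intrinsicInterior
    (convex_subdiff (sepSum_eq_coe hs)) (convex_subdiff (sepSum_eq_coe ht)) T h0
    (r + ∑ j, (r + ‖y₀ j‖))
  set B := ‖LinearMap.toContinuousLinearMap T‖ with hB
  refine ⟨1 + K * (1 + B), by positivity, fun y hy => ?_⟩
  choose q hq hqd using fun i => (isClosed_subdiff (hs i)).exists_infDist_eq_dist
    ⟨_, hy₀.1 i⟩ (dualArg A i y)
  choose p hp hpd using fun j => (isClosed_subdiff (ht j)).exists_infDist_eq_dist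
    ⟨_, hy₀.2 j⟩ (y j)
  set d₁ := ∑ i, Metric.infDist (dualArg A i y) (subdiff (f i) (x i)) with hd₁
  set d₂ := ∑ j, Metric.infDist (y j) (subdiff (g j) (blockMap A x j)) with hd₂
  have hd₁0 : 0 ≤ d₁ := Finset.sum_nonneg fun _ _ => Metric.infDist_nonneg
  have hd₂0 : 0 ≤ d₂ := Finset.sum_nonneg fun _ _ => Metric.infDist_nonneg
  have hyp : ‖y - WithLp.toLp 2 p‖ ≤ d₂ := by
    refine (norm_le_sum_norm _).trans (Finset.sum_le_sum fun j _ => ?_)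
    rw [hpd j, dist_eq_norm]
    rfl
  have hqy : ‖WithLp.toLp 2 q + T y‖ ≤ d₁ := by
    refine (norm_le_sum_norm _).trans (Finset.sum_le_sum fun i _ => ?_)
    rw [hqd i, dist_comm, dist_eq_norm, dualArg_eq, PiLp.neg_apply, sub_neg_eq_add]
    rfl
  have hpn : ‖WithLp.toLp 2 p‖ ≤ r + ∑ j, (r + ‖y₀ j‖) := by
    have h1 : d₂ ≤ ∑ j, (r + ‖y₀ j‖) := Finset.sum_le_sum fun j _ =>
      (Metric.infDist_le_dist_of_mem (hy₀.2 j)).trans ((dist_le_norm_add_norm _ _).trans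
        (add_le_add ((PiLp.norm_apply_le y j).trans hy) le_rfl))
    have h2 := norm_sub_le y (y - WithLp.toLp 2 p)
    rw [sub_sub_cancel] at h2
    linarith
  have hmain := hbd (WithLp.toLp 2 p) ((mem_subdiff_sepSum hg ht).2 hp) hpn
    (WithLp.toLp 2 q) ((mem_subdiff_sepSum hf hs).2 hq)
  rw [← hcert] at hmain
  have hdef : ‖WithLp.toLp 2 q + T (WithLp.toLp 2 p)‖ ≤ d₁ + B * d₂ := by
    have h1 : WithLp.toLp 2 q + T (WithLp.toLp 2 p) =
        (WithLp.toLp 2 q + T y) - T (y - WithLp.toLp 2 p) := by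
      rw [map_sub]
      abel
    rw [h1]
    refine (norm_sub_le _ _).trans (add_le_add hqy ?_)
    exact ((LinearMap.toContinuousLinearMap T).le_opNorm _).trans
      (mul_le_mul_of_nonneg_left hyp (norm_nonneg _))
  have htri := Metric.infDist_le_infDist_add_dist (x := y) (y := WithLp.toLp 2 p)
    (s := certificates f g A x)
  rw [dist_eq_norm] at htri
  have hB0 : 0 ≤ B := norm_nonneg _
  have h3 : K * (d₁ + B * d₂) ≤ K * ((1 + B) * (d₁ + d₂)) :=
    mul_le_mul_of_nonneg_left (by nlinarith) hK
  have h4 := mul_le_mul_of_nonneg_left hdef hK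
  change _ ≤ (1 + K * (1 + B)) * (d₁ + d₂)
  linarith

/-- Equality in Fenchel–Young: at a certificate the dual objective is at most the negative of the
primal value. -/
theorem dualObj_le_of_mem_certificates (hs : ∀ i, f i (x i) = s i)
    (ht : ∀ j, g j (blockMap A x j) = t j) {y : PiLp 2 Y} (hy : y ∈ certificates f g A x) :
    dualObj f g A y ≤ ((-(∑ i, s i + ∑ j, t j) : ℝ) : EReal) := by
  have h := sum_inner_dualArg A x y
  have h1 : -(∑ i, s i + ∑ j, t j) =
      ∑ i, (⟪x i, dualArg A i y⟫_ℝ - s i) + ∑ j, (⟪blockMap A x j, y j⟫_ℝ - t j) := by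
    rw [Finset.sum_sub_distrib, Finset.sum_sub_distrib]
    linarith
  rw [h1, EReal.coe_add, ereal_coe_sum, ereal_coe_sum]
  refine add_le_add (Finset.sum_le_sum fun i _ => ?_) (Finset.sum_le_sum fun j _ => ?_)
  · rw [← dualArg_apply]
    exact conjugate_le_of_mem_subdiff (hs i) (hy.1 i)
  · exact conjugate_le_of_mem_subdiff (ht j) (hy.2 j)

/-- On balls the dual objective exceeds the negative of the primal value by a multiple of the
squared defect. -/
theorem exists_dualObj_growth (hf : ∀ i, IsGammaZero (f i)) (hg : ∀ j, IsGammaZero (g j))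
    (hs : ∀ i, f i (x i) = s i) (ht : ∀ j, g j (blockMap A x j) = t j)
    (hlf : ∀ i, BoundedUpperLipschitzAt (subdiff (f i)) (x i))
    (hlg : ∀ j, BoundedUpperLipschitzAt (subdiff (g j)) (blockMap A x j))
    (hne : (certificates f g A x).Nonempty) (r : ℝ) :
    ∃ c > (0 : ℝ), ∀ y, ‖y‖ ≤ r →
      ((-(∑ i, s i + ∑ j, t j) + c * certificateDefect f g A x y ^ 2 : ℝ) : EReal) ≤
        dualObj f g A y := by
  obtain ⟨y₀, hy₀⟩ := hne
  choose a ha hfa using fun i => conjugate_growth (hf i) (hs i) ⟨_, hy₀.1 i⟩ (hlf i)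
    (‖LinearMap.toContinuousLinearMap (dualArg A i)‖ * r)
  choose b hb hgb using fun j => conjugate_growth (hg j) (ht j) ⟨_, hy₀.2 j⟩ (hlg j) r
  obtain ⟨m, hm, hmc⟩ := exists_pos_le (ι := I ⊕ J) (c := Sum.elim a b) (by
    rintro (i | j)
    · exact ha i
    · exact hb j)
  set N : ℝ := (Fintype.card (I ⊕ J) : ℝ)
  refine ⟨m / (N + 1), by positivity, fun y hy => ?_⟩
  let δ : I ⊕ J → ℝ := Sum.elim
    (fun i => Metric.infDist (dualArg A i y) (subdiff (f i) (x i)))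
    (fun j => Metric.infDist (y j) (subdiff (g j) (blockMap A x j)))
  have hδ : certificateDefect f g A x y = ∑ k, δ k := by
    rw [Fintype.sum_sum_type]
    rfl
  have hsq : m / (N + 1) * certificateDefect f g A x y ^ 2 ≤ ∑ k, Sum.elim a b k * δ k ^ 2 := by
    have h1 : (∑ k, δ k) ^ 2 ≤ N * ∑ k, δ k ^ 2 := sq_sum_le_card_mul_sum_sq
    have h2 : 0 ≤ ∑ k, δ k ^ 2 := Finset.sum_nonneg fun k _ => sq_nonneg _
    calc m / (N + 1) * certificateDefect f g A x y ^ 2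
        ≤ m / (N + 1) * ((N + 1) * ∑ k, δ k ^ 2) := by
          rw [hδ]
          gcongr
          linarith
      _ = ∑ k, m * δ k ^ 2 := by
          rw [← Finset.mul_sum]
          have hN : N + 1 ≠ 0 := by positivity
          field_simp
      _ ≤ _ := Finset.sum_le_sum fun k _ => mul_le_mul_of_nonneg_right (hmc k) (sq_nonneg _)
  rw [Fintype.sum_sum_type] at hsq
  have h := sum_inner_dualArg A x y
  have h1 : -(∑ i, s i + ∑ j, t j) + m / (N + 1) * certificateDefect f g A x y ^ 2 ≤
      ∑ i, (⟪x i, dualArg A i y⟫_ℝ - s i +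
        a i * Metric.infDist (dualArg A i y) (subdiff (f i) (x i)) ^ 2) +
      ∑ j, (⟪blockMap A x j, y j⟫_ℝ - t j +
        b j * Metric.infDist (y j) (subdiff (g j) (blockMap A x j)) ^ 2) := by
    simp only [Finset.sum_add_distrib, Finset.sum_sub_distrib]
    simp only [Sum.elim_inl, Sum.elim_inr, δ] at hsq
    linarith
  refine (EReal.coe_le_coe_iff.2 h1).trans ?_
  rw [EReal.coe_add, ereal_coe_sum, ereal_coe_sum]
  refine add_le_add (Finset.sum_le_sum fun i _ => ?_) (Finset.sum_le_sum fun j _ => ?_)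
  · rw [← dualArg_apply]
    refine hfa i _ (((LinearMap.toContinuousLinearMap (dualArg A i)).le_opNorm y).trans ?_)
    exact mul_le_mul_of_nonneg_left hy (norm_nonneg _)
  · exact hgb j _ ((PiLp.norm_apply_le y j).trans hy)

end Dual

end CompositeDual

theorem proposition2 {I J : Type*} [Fintype I] [Fintype J]
    {X : I → Type*} [∀ i, NormedAddCommGroup (X i)] [∀ i, InnerProductSpace ℝ (X i)]
    [∀ i, FiniteDimensional ℝ (X i)]
    {Y : J → Type*} [∀ j, NormedAddCommGroup (Y j)] [∀ j, InnerProductSpace ℝ (Y j)]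
    [∀ j, FiniteDimensional ℝ (Y j)]
    (f : ∀ i, X i → EReal) (g : ∀ j, Y j → EReal) (A : ∀ j i, X i →ₗ[ℝ] Y j)
    (hf : ∀ i, IsGammaZero (f i)) (hg : ∀ j, IsGammaZero (g j))
    (hcq : ConstraintQualification (sepSum f) (sepSum g) (blockMap A))
    (xbar : PiLp 2 X) (hxbar : ∀ x, primalObj f g A xbar ≤ primalObj f g A x)
    (hesc : EssentiallyStrictlyConvex (sepSum f))
    (hcond :
      ((∀ i, UpperLipschitzAt (subdiff (f i)) (xbar i)) ∧
        (∀ j, UpperLipschitzAt (subdiff (g j)) (blockMap A xbar j)) ∧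
        (0 : PiLp 2 X) ∈ intrinsicInterior ℝ
          (subdiff (sepSum f) xbar +
            (blockMap A).adjoint '' subdiff (sepSum g) (blockMap A xbar))) ∨
      ((∀ i, IsPolyhedralMap (subdiff (f i))) ∧ (∀ j, IsPolyhedralMap (subdiff (g j))))) :
    (∃ d : ℝ, (⨅ y, dualObj f g A y) = (d : EReal)) ∧
      (minimizers (dualObj f g A)).Nonempty ∧
      BoundedQuadraticGrowth (dualObj f g A) := by
  have hfb : ∀ i u, f i u ≠ ⊥ := fun i => (hf i).ne_bot
  have hgb : ∀ j z, g j z ≠ ⊥ := fun j => (hg j).ne_bot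
  have hfs : ∀ x, sepSum f x ≠ ⊥ := fun x => ereal_sum_ne_bot _ fun i => hfb i _
  have hgs : ∀ z, sepSum g z ≠ ⊥ := fun z => ereal_sum_ne_bot _ fun j => hgb j _
  -- the primal value is finite
  have hfin : sepSum f xbar + sepSum g (blockMap A xbar) < ⊤ := by
    obtain ⟨x, hx, hAx⟩ := hcq.exists_feasible
    exact lt_of_le_of_lt (hxbar x) (EReal.add_lt_top (ne_of_lt hx) (ne_of_lt hAx))
  have hfx : sepSum f xbar < ⊤ := by
    refine lt_top_iff_ne_top.2 fun h => ?_
    rw [h, EReal.top_add_of_ne_bot (hgs _)] at hfin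
    exact lt_irrefl _ hfin
  have hgx : sepSum g (blockMap A xbar) < ⊤ := by
    refine lt_top_iff_ne_top.2 fun h => ?_
    rw [h, EReal.add_top_of_ne_bot (hfs _)] at hfin
    exact lt_irrefl _ hfin
  obtain ⟨s, hs⟩ := exists_real_of_sum_lt_top (fun i => hfb i (xbar i)) hfx
  obtain ⟨t, ht⟩ := exists_real_of_sum_lt_top (fun j => hgb j (blockMap A xbar j)) hgx
  have hne : (certificates f g A xbar).Nonempty := by
    obtain ⟨y, hy, hAy⟩ := exists_subgradient_of_minimizer
      hfs hgs
      (convex_epigraph_sepSum hfb fun i => (hf i).convex_epigraph)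
      (convex_epigraph_sepSum hgb fun j => (hg j).convex_epigraph)
      hcq (sepSum_eq_coe hs) (sepSum_eq_coe ht) hxbar
    exact ⟨y, (mem_subdiff_sepSum hfb hs).1 hAy, (mem_subdiff_sepSum hgb ht).1 hy⟩
  have hlip : (∀ i, BoundedUpperLipschitzAt (subdiff (f i)) (xbar i)) ∧
      ∀ j, BoundedUpperLipschitzAt (subdiff (g j)) (blockMap A xbar j) := by
    obtain ⟨y, hy⟩ := hne
    rcases hcond with ⟨h1, h2, -⟩ | ⟨h1, h2⟩
    · exact ⟨fun i => (h1 i).bounded, fun j => (h2 j).bounded⟩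
    · exact ⟨fun i => (h1 i).boundedUpperLipschitzAt ⟨_, hy.1 i⟩,
        fun j => (h2 j).boundedUpperLipschitzAt ⟨_, hy.2 j⟩⟩
  have hreg : ∀ r : ℝ, ∃ K : ℝ, 0 ≤ K ∧ ∀ y, ‖y‖ ≤ r →
      Metric.infDist y (certificates f g A xbar) ≤ K * certificateDefect f g A xbar y := by
    rcases hcond with ⟨-, -, h0⟩ | ⟨h1, h2⟩
    · exact exists_infDist_certificates_le_of_intrinsicInterior hfb hgb hs ht h0 hne
    · exact exists_infDist_certificates_le_of_polyhedral hs ht h1 h2 hne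
  have hgrowth := exists_dualObj_growth hf hg hs ht hlip.1 hlip.2 hne
  set d := -(∑ i, s i + ∑ j, t j) with hd
  have hlow : ∀ y, (d : EReal) ≤ dualObj f g A y := fun y => by
    obtain ⟨c, hc, hcy⟩ := hgrowth ‖y‖
    refine le_trans (EReal.coe_le_coe_iff.2 ?_) (hcy y le_rfl)
    have := mul_nonneg hc.le (sq_nonneg (certificateDefect f g A xbar y))
    linarith
  have hsub : certificates f g A xbar ⊆ minimizers (dualObj f g A) := fun y hy z =>
    (dualObj_le_of_mem_certificates hs ht hy).trans (hlow z)
  have hinf : (⨅ y, dualObj f g A y) = (d : EReal) := by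
    obtain ⟨y, hy⟩ := hne
    exact le_antisymm ((iInf_le _ y).trans (dualObj_le_of_mem_certificates hs ht hy))
      (le_iInf hlow)
  refine ⟨⟨d, hinf⟩, hne.mono hsub, fun r _ => ?_⟩
  obtain ⟨K, hK, hKy⟩ := hreg r
  obtain ⟨c, hc, hcy⟩ := hgrowth r
  refine ⟨2 * c / (K ^ 2 + 1), by positivity, fun y hy => ?_⟩
  have hyr : ‖y‖ ≤ r := by simpa using hy
  rw [hinf, ← EReal.coe_add]
  refine le_trans (EReal.coe_le_coe_iff.2 (add_le_add le_rfl ?_)) (hcy y hyr)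
  have hdist : Metric.infDist y (minimizers (dualObj f g A)) ^ 2 ≤
      (K * certificateDefect f g A xbar y) ^ 2 :=
    pow_le_pow_left₀ Metric.infDist_nonneg
      ((Metric.infDist_le_infDist_of_subset hsub hne).trans (hKy y hyr)) 2
  calc 2 * c / (K ^ 2 + 1) / 2 * Metric.infDist y (minimizers (dualObj f g A)) ^ 2
      = c / (K ^ 2 + 1) * Metric.infDist y (minimizers (dualObj f g A)) ^ 2 := by ring
    _ ≤ c / (K ^ 2 + 1) * ((K ^ 2 + 1) * certificateDefect f g A xbar y ^ 2) := by
        gcongr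
        rw [mul_pow] at hdist
        nlinarith [sq_nonneg (certificateDefect f g A xbar y)]
    _ = c * certificateDefect f g A xbar y ^ 2 := by field_simp
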